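/- Let $N\in\mathbb N$ and let $p,m,\sigma$ be real numbers with $N>p\ge 2$, $m>p-1$ and $\sigma\ge 0$. For $r\ge 0$ put $$v^*(r)=1-\left[\frac{m+p-1}{(N+\sigma)(p-1)+(N-p)m}\Big(\frac{m+p-1}{p+\sigma}\Big)^{p-1}\right]^{\frac1{m+p-1}} r^{\frac{p+\sigma}{m+p-1}} .$$ Here $\Delta_p v=\operatorname{div}(|\nabla v|^{p-2}\nabla v)$, $B_{r_0}$ is the open ball in $\mathbb R^N$ of radius $r_0$ centred at the origin, and a solution of $-\Delta_p v=|x|^\sigma/(1-v)^m$, $v<1$, in an open set is a $C^1$ function for which $|\nabla v|^{p-2}\nabla v$ is differentiable and which satisfies the equation and the inequality at every point of that set. A radial function is identified with its profile in $r=|x|$. There is $r_0>0$ such that the following hold. (i) $v^*$ is the unique radial function that is continuous on $B_{r_0}$, equals $1$ at the origin, and solves $$-\Delta_p v=\frac{|x|^\sigma}{(1-v)^m},\quad v<1,\qquad\text{in } B_{r_0}\setminus\{0\}.$$ (ii) For every $a\in(0,1)$ there is a radial solution $v(\cdot,a)$ of $-\Delta_p v=|x|^\sigma/(1-v)^m$,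 $v<1$, in the whole ball $B_{r_0}$ with $v(0,a)=a$. Its profile is $C^2$ on $(0,r_0)$, and it is unique, even among the radial functions that are continuous on $B_{r_0}$, equal $a$ at the origin, and solve the problem in $B_{r_0}\setminus\{0\}$. For all $a<1$ sufficiently close to $1$ one has $0<v(\cdot,a)<1$ in $B_{r_0}$. Moreover: (ii1) $v(\cdot,a)\to v^*$ in $C^2_{\rm loc}(0,r_0)\cap C_{\rm loc}[0,r_0)$ as $a\to 1^-$. (ii2) Let $$D=4\Big(\sqrt{(p-1)\{\sigma(p-1)+p(N-1)\}}-\sqrt{p+\sigma}\Big)^2-2p^2(p+\sigma),\qquad q_c=\frac12+\frac{p^2(p+\sigma)}{D}\ \text{ if } D>0,\qquad q_c=+\infty\ \text{ if } D\le 0 .$$ If $\frac{m}{m-p+1}<q_c$, then for every $\rho\in(0,r_0)$ the number (possibly infinite) of points $r\in(0,\rho)$ with $v(r,a)=v^*(r)$ tends to $\infty$ as $a\to 1^-$. -/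

import Mathlib

open Set Filter Topology

namespace MEMS

noncomputable section

/-- `ℝ^N` with the Euclidean norm. -/
abbrev Space (N : ℕ) : Type := EuclideanSpace ℝ (Fin N)

/-- The vector field `|∇v|^(p-2) ∇v`. -/
def pFlux {N : ℕ} (p : ℝ) (v : Space N → ℝ) (x : Space N) : Space N :=
  ‖gradient v x‖ ^ (p - 2) • gradient v x

/-- The divergence `∑ i, ∂ᵢ Fᵢ`. -/
def divergence {N : ℕ} (F : Space N → Space N) (x : Space N) : ℝ :=
  ∑ i : Fin N, (fderiv ℝ F x (EuclideanSpace.single i 1)) i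

/-- The `p`-Laplacian `Δ_p v = div (|∇v|^(p-2) ∇v)`. -/
def pLaplacian {N : ℕ} (p : ℝ) (v : Space N → ℝ) (x : Space N) : ℝ :=
  divergence (pFlux p v) x

/-- `v` is a classical solution of `-Δ_p v = |x|^σ / (1 - v)^m`, `v < 1`, in the open set `U`:
`v` is continuously differentiable, the field `|∇v|^(p-2) ∇v` is differentiable, and the
equation holds at every point of `U`. (A `C²` function has this regularity when `p ≥ 2`;
near a critical point solutions need not be `C²`.) -/
structure Solves {N : ℕ} (p σ m : ℝ) (U : Set (Space N)) (v : Space N → ℝ) : Prop where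
  contDiffOn : ContDiffOn ℝ 1 v U
  differentiableOn_flux : DifferentiableOn ℝ (pFlux p v) U
  lt_one : ∀ x ∈ U, v x < 1
  equation : ∀ x ∈ U, -pLaplacian p v x = ‖x‖ ^ σ / (1 - v x) ^ m

/-- The radial function on `ℝ^N` with profile `w`. -/
def radial (N : ℕ) (w : ℝ → ℝ) (x : Space N) : ℝ := w ‖x‖

/-- The profile `w` (only its values on `[0, r₀)` matter) gives a radial function on the ball
`B_{r₀}` which is continuous, solves the equation in `B_{r₀} \ {0}`, and has the value `a` at
the origin. -/
structure IsRadialSolution (N : ℕ) (p σ m r₀ a : ℝ) (w : ℝ → ℝ) : Prop where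
  continuousOn : ContinuousOn w (Ico 0 r₀)
  value_zero : w 0 = a
  solves : Solves p σ m (Metric.ball (0 : Space N) r₀ \ {0}) (radial N w)

/-- The explicit function `v*`. -/
def vStar (N : ℕ) (p σ m : ℝ) (r : ℝ) : ℝ :=
  1 - ((m + p - 1) / ((N + σ) * (p - 1) + (N - p) * m)
        * ((m + p - 1) / (p + σ)) ^ (p - 1)) ^ (1 / (m + p - 1))
      * r ^ ((p + σ) / (m + p - 1))

/-- The denominator occurring in the critical exponent `q_c`. -/
def qcDenom (N : ℕ) (p σ : ℝ) : ℝ :=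
  4 * (√((p - 1) * (σ * (p - 1) + p * (N - 1))) - √(p + σ)) ^ 2 - 2 * p ^ 2 * (p + σ)

/-- The critical exponent `q_c`, meaningful when its denominator is positive. -/
def qc (N : ℕ) (p σ : ℝ) : ℝ :=
  1 / 2 + p ^ 2 * (p + σ) / qcDenom N p σ

/-- The zero number of `h` on `I`, possibly infinite. -/
def zeroNumber (I : Set ℝ) (h : ℝ → ℝ) : ℕ∞ := {r ∈ I | h r = 0}.encard

/-- Convergence `v(·, a) → V` along the filter `l` in `C²_loc(0, r₀) ∩ C_loc[0, r₀)`. -/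
structure ConvergesLoc (r₀ : ℝ) (l : Filter ℝ) (v : ℝ → ℝ → ℝ) (V : ℝ → ℝ) : Prop where
  c0 : ∀ K ⊆ Ico 0 r₀, IsCompact K → TendstoUniformlyOn v V l K
  c1 : ∀ K ⊆ Ioo 0 r₀, IsCompact K →
    TendstoUniformlyOn (fun a => deriv (v a)) (deriv V) l K
  c2 : ∀ K ⊆ Ioo 0 r₀, IsCompact K →
    TendstoUniformlyOn (fun a => deriv (deriv (v a))) (deriv (deriv V)) l K

end

end MEMS

/-!
Put `u = 1 - v`. A radial function `v` solves the equation away from the origin exactly when the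
flux `W = r ^ (N - 1) |u'| ^ (p - 2) u'` satisfies `W' = r ^ (N - 1 + σ) / u ^ m`. If `u` is
continuous at the origin, then `W → 0` there, because a flux bounded away from zero would give
`|u'| ≥ c / r` (`SignedProfile.flux`; this is where `p < N` enters). So `u` is increasing, and

* if `u(0) = α > 0`, then `u` solves a Volterra integral equation, which has a unique solution, and
  that solution is entire (`exists_picard_eq`, `eqOn_of_picard_eq`);
* in the variables `X = r u' / u` and `Z = r W' / W` the equation becomes the Lotka–Volterra system
  `r X' = X ((Z - (N - p)) / (p - 1) - X)`, `r Z' = Z (N + σ - m X - Z)`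
  (`ProfileSolution.lotkaVolterra`).

The system has one equilibrium `(θ, ζ)` in the open quadrant; it corresponds to the homogeneous
solution `A r ^ θ = 1 - v*`. A combination of functions `x - a - a log (x / a)` is a strict Lyapunov
function. Since `dr / r` has infinite mass at `0` and at `∞`, two things follow: every entire profile
is asymptotic to `A r ^ θ` together with two derivatives (`LotkaVolterra.tendsto_atTop`), and a
solution along which the Lyapunov function is bounded near the origin is the equilibrium
(`LotkaVolterra.eq_equilibrium`). A profile with `u(0) = 0` lies between multiples of `r ^ θ`
(`ProfileSolution.exists_bounds`), so the second fact gives the uniqueness of `v*`.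

If `u` is the entire profile with `u(0) = 1`, then the solution with value `a` at the origin is
`1 - μ ^ θ u(r / μ)` with `μ ^ θ = 1 - a`. As `a → 1` the scale `μ` tends to `0`, so the convergence
to `v*` is the asymptotic behaviour of `u` at infinity, and the intersections with `v*` in `(0, ρ)`
are those of `u` with `A r ^ θ` in `(0, ρ / μ)`. The condition on `q_c` says that the equilibrium is a
focus (`oscillation_condition`), and then a Riccati argument shows that `u - A r ^ θ` has arbitrarily
large zeros (`ProfileSolution.exists_eq_amplitude_mul_rpow`).
-/

namespace MEMS

/-! ### Monotonicity criteria on half-lines and at the origin -/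

lemma monotoneOn_of_hasDerivAt_nonneg {s : Set ℝ} (hs : Convex ℝ s) (hso : IsOpen s)
    {f f' : ℝ → ℝ} (hf : ∀ r ∈ s, HasDerivAt f (f' r) r) (hf' : ∀ r ∈ s, 0 ≤ f' r) :
    MonotoneOn f s := by
  refine monotoneOn_of_hasDerivWithinAt_nonneg (f' := f') hs
    (fun r hr => (hf r hr).continuousAt.continuousWithinAt) ?_ ?_
  · intro r hr
    rw [hso.interior_eq] at hr
    exact (hf r hr).hasDerivWithinAt
  · intro r hr
    rw [hso.interior_eq] at hr
    exact hf' r hr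

lemma antitoneOn_of_hasDerivAt_nonpos {s : Set ℝ} (hs : Convex ℝ s) (hso : IsOpen s)
    {f f' : ℝ → ℝ} (hf : ∀ r ∈ s, HasDerivAt f (f' r) r) (hf' : ∀ r ∈ s, f' r ≤ 0) :
    AntitoneOn f s := by
  have := monotoneOn_of_hasDerivAt_nonneg hs hso (f := fun r => -f r) (f' := fun r => -f' r)
    (fun r hr => (hf r hr).neg) (fun r hr => by linarith [hf' r hr])
  intro a ha b hb hab
  have h := this ha hb hab
  simp only at h
  linarith

/-- A function vanishing at `0+` with nonnegative derivative is nonnegative. -/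
lemma nonneg_of_hasDerivAt_nonneg_of_tendsto_zero {R : ℝ} {f f' : ℝ → ℝ}
    (hf : ∀ r ∈ Ioo 0 R, HasDerivAt f (f' r) r) (hf' : ∀ r ∈ Ioo 0 R, 0 ≤ f' r)
    (h0 : Tendsto f (𝓝[>] 0) (𝓝 0)) {r : ℝ} (hr : r ∈ Ioo 0 R) : 0 ≤ f r := by
  have hmono := monotoneOn_of_hasDerivAt_nonneg (convex_Ioo 0 R) isOpen_Ioo hf hf'
  refine le_of_tendsto h0 ?_
  filter_upwards [Ioo_mem_nhdsGT hr.1] with s hs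
  exact hmono ⟨hs.1, hs.2.trans hr.2⟩ hr hs.2.le

/-- Two functions with the limit `0` at `0+` compare as their derivatives do. -/
lemma le_of_hasDerivAt_le_of_tendsto_zero {R : ℝ} {f f' g g' : ℝ → ℝ}
    (hf : ∀ r ∈ Ioo 0 R, HasDerivAt f (f' r) r) (hg : ∀ r ∈ Ioo 0 R, HasDerivAt g (g' r) r)
    (hle : ∀ r ∈ Ioo 0 R, f' r ≤ g' r)
    (hf0 : Tendsto f (𝓝[>] 0) (𝓝 0)) (hg0 : Tendsto g (𝓝[>] 0) (𝓝 0))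
    {r : ℝ} (hr : r ∈ Ioo 0 R) : f r ≤ g r := by
  have := nonneg_of_hasDerivAt_nonneg_of_tendsto_zero (f := fun r => g r - f r)
    (f' := fun r => g' r - f' r) (fun r hr => (hg r hr).sub (hf r hr))
    (fun r hr => by linarith [hle r hr]) (by simpa using hg0.sub hf0) hr
  linarith

/-- If `r f'(r) ≤ -δ < 0` near `0`, then `f` is unbounded above there: the measure `dr/r` is
infinite at the origin. -/
lemma exists_gt_of_mul_deriv_le_near_zero {R δ : ℝ} (hR : 0 < R) (hδ : 0 < δ) {f f' : ℝ → ℝ}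
    (hf : ∀ r ∈ Ioo 0 R, HasDerivAt f (f' r) r) (hf' : ∀ r ∈ Ioo 0 R, r * f' r ≤ -δ) (B : ℝ) :
    ∃ r ∈ Ioo 0 R, B < f r := by
  have hanti := antitoneOn_of_hasDerivAt_nonpos (convex_Ioo 0 R) isOpen_Ioo
    (f := fun r => f r + δ * Real.log r) (f' := fun r => f' r + δ * r⁻¹)
    (fun r hr => (hf r hr).add ((Real.hasDerivAt_log hr.1.ne').const_mul δ))
    (fun r hr => by
      have h1 := hf' r hr
      have hr0 := hr.1
      have : f' r + δ * r⁻¹ = (r * f' r + δ) / r := by field_simp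
      rw [this]
      exact div_nonpos_of_nonpos_of_nonneg (by linarith) hr0.le)
  have hlim : Tendsto (fun r => f (R / 2) + δ * Real.log (R / 2) - δ * Real.log r)
      (𝓝[>] 0) atTop := by
    simp only [sub_eq_add_neg]
    refine tendsto_atTop_add_const_left _ _ ?_
    simp only [← mul_neg]
    exact (tendsto_neg_atBot_atTop.comp Real.tendsto_log_nhdsGT_zero).const_mul_atTop hδ
  have h2 : (0:ℝ) < R / 2 := by linarith
  have hev : ∀ᶠ r in 𝓝[>] (0 : ℝ), r ∈ Ioo 0 (R / 2) := Ioo_mem_nhdsGT h2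
  obtain ⟨r, hr, hrB⟩ := (hev.and (hlim.eventually_gt_atTop B)).exists
  refine ⟨r, ⟨hr.1, by linarith [hr.2]⟩, ?_⟩
  have := hanti (a := r) (b := R / 2) ⟨hr.1, by linarith [hr.2]⟩ ⟨h2, by linarith⟩ hr.2.le
  simp only at this
  linarith

/-- If `r f'(r) ≤ -δ < 0` near `∞`, then `f` is unbounded below there. -/
lemma exists_lt_of_mul_deriv_le_near_top {R δ : ℝ} (hR : 0 ≤ R) (hδ : 0 < δ) {f f' : ℝ → ℝ}
    (hf : ∀ r ∈ Ioi R, HasDerivAt f (f' r) r) (hf' : ∀ r ∈ Ioi R, r * f' r ≤ -δ) (B : ℝ) :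
    ∃ r ∈ Ioi R, f r < B := by
  have hanti := antitoneOn_of_hasDerivAt_nonpos (convex_Ioi R) isOpen_Ioi
    (f := fun r => f r + δ * Real.log r) (f' := fun r => f' r + δ * r⁻¹)
    (fun r hr => (hf r hr).add
      ((Real.hasDerivAt_log (hR.trans_lt hr).ne').const_mul δ))
    (fun r hr => by
      have h1 := hf' r hr
      have hr0 := hR.trans_lt hr
      have : f' r + δ * r⁻¹ = (r * f' r + δ) / r := by field_simp
      rw [this]
      exact div_nonpos_of_nonpos_of_nonneg (by linarith) hr0.le)
  have hlim : Tendsto (fun r => δ * Real.log r - (f (R + 1) + δ * Real.log (R + 1)))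
      atTop atTop := by
    simp only [sub_eq_add_neg]
    exact tendsto_atTop_add_const_right _ _ (Real.tendsto_log_atTop.const_mul_atTop hδ)
  obtain ⟨r, hr, hrB⟩ := ((eventually_ge_atTop (R + 1)).and
      (hlim.eventually_gt_atTop (-B))).exists
  have hr' : r ∈ Ioi R := by simp only [mem_Ioi]; linarith
  refine ⟨r, hr', ?_⟩
  have := hanti (a := R + 1) (b := r) (by simp) hr' hr
  simp only at this
  linarith

/-! ### The Lotka–Volterra system -/

/-- The range of parameters of the problem; `n` is the dimension, as a real number. -/
structure Admissible (n p m σ : ℝ) : Prop where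
  two_le : 2 ≤ p
  lt_dim : p < n
  lt_exp : p - 1 < m
  nonneg : 0 ≤ σ

/-- The exponent `θ` of the homogeneous solution `A r ^ θ`, which is also the first coordinate
of the equilibrium of the Lotka–Volterra system. -/
noncomputable def theta (p m σ : ℝ) : ℝ := (p + σ) / (m + p - 1)

/-- The second coordinate of the equilibrium of the Lotka–Volterra system. -/
noncomputable def zeta (n p m σ : ℝ) : ℝ := n + σ - m * theta p m σ

section Parameters

variable {n p m σ : ℝ}

lemma Admissible.sub_one_pos (h : Admissible n p m σ) : 0 < p - 1 := by linarith [h.two_le]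

lemma Admissible.m_pos (h : Admissible n p m σ) : 0 < m := by
  linarith [h.two_le, h.lt_exp]

lemma Admissible.exp_pos (h : Admissible n p m σ) : 0 < m + p - 1 := by
  linarith [h.two_le, h.lt_exp]

lemma Admissible.n_add_pos (h : Admissible n p m σ) : 0 < n + σ := by
  linarith [h.two_le, h.lt_dim, h.nonneg]

lemma Admissible.theta_pos (h : Admissible n p m σ) : 0 < theta p m σ :=
  div_pos (by linarith [h.two_le, h.nonneg]) h.exp_pos

lemma Admissible.exp_mul_theta (h : Admissible n p m σ) :
    (m + p - 1) * theta p m σ = p + σ := by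
  have := h.exp_pos.ne'
  unfold theta
  field_simp

lemma Admissible.zeta_eq (h : Admissible n p m σ) :
    zeta n p m σ = n - p + (p - 1) * theta p m σ := by
  have := h.exp_mul_theta
  unfold zeta
  linarith

lemma Admissible.zeta_pos (h : Admissible n p m σ) : 0 < zeta n p m σ := by
  rw [h.zeta_eq]
  have := mul_pos h.sub_one_pos h.theta_pos
  linarith [h.lt_dim]

end Parameters

/-- The convex function of `x` that vanishes to second order at `a`, from which Lyapunov
functions of Lotka–Volterra systems are built. -/
noncomputable def relEntropy (a x : ℝ) : ℝ := x - a - a * Real.log (x / a)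

lemma sq_sqrt_sub_sqrt_le_relEntropy {a x : ℝ} (ha : 0 < a) (hx : 0 < x) :
    (√x - √a) ^ 2 ≤ relEntropy a x := by
  have hsa := Real.sqrt_pos.2 ha
  have hsx := Real.sqrt_pos.2 hx
  have ha2 := Real.mul_self_sqrt ha.le
  have hx2 := Real.mul_self_sqrt hx.le
  have h1 : Real.log (x / a) = 2 * Real.log (√x / √a) := by
    rw [Real.log_div hx.ne' ha.ne', Real.log_div hsx.ne' hsa.ne', Real.log_sqrt hx.le,
      Real.log_sqrt ha.le]
    ring
  have h2 : Real.log (√x / √a) ≤ √x / √a - 1 := Real.log_le_sub_one_of_pos (by positivity)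
  have h3 : a * (√x / √a) = √a * √x := by
    field_simp
    nlinarith
  have h4 := mul_le_mul_of_nonneg_left h2 ha.le
  unfold relEntropy
  rw [h1]
  nlinarith

lemma relEntropy_nonneg {a x : ℝ} (ha : 0 < a) (hx : 0 < x) : 0 ≤ relEntropy a x :=
  (sq_nonneg _).trans (sq_sqrt_sub_sqrt_le_relEntropy ha hx)

lemma eq_of_relEntropy_le_zero {a x : ℝ} (ha : 0 < a) (hx : 0 < x) (h : relEntropy a x ≤ 0) :
    x = a := by
  have h1 := (sq_sqrt_sub_sqrt_le_relEntropy ha hx).trans h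
  have h2 : √x - √a = 0 := by
    have := le_antisymm h1 (sq_nonneg _)
    exact pow_eq_zero_iff (two_ne_zero) |>.1 this
  have h3 : √x = √a := by linarith
  exact (Real.sqrt_inj hx.le ha.le).1 h3

lemma relEntropy_self {a : ℝ} (ha : 0 < a) : relEntropy a a = 0 := by
  simp [relEntropy, div_self ha.ne']

lemma continuousAt_relEntropy {a : ℝ} (ha : 0 < a) : ContinuousAt (relEntropy a) a := by
  unfold relEntropy
  have : a / a ≠ 0 := by rw [div_self ha.ne']; exact one_ne_zero
  fun_prop (disch := assumption)

lemma hasDerivAt_relEntropy {a x : ℝ} (ha : 0 < a) (hx : 0 < x) :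
    HasDerivAt (relEntropy a) (1 - a / x) x := by
  unfold relEntropy
  have h := ((hasDerivAt_id' x).div_const a).log (div_pos hx ha).ne'
  refine (((hasDerivAt_id' x).sub_const a).sub (h.const_mul a)).congr_deriv ?_
  field_simp

lemma tendsto_of_relEntropy_tendsto_zero {ι : Type*} {l : Filter ι} {a : ℝ} (ha : 0 < a)
    {X : ι → ℝ} (hX : ∀ᶠ r in l, 0 < X r)
    (h : Tendsto (fun r => relEntropy a (X r)) l (𝓝 0)) : Tendsto X l (𝓝 a) := by
  have h1 : Tendsto (fun r => (√(X r) - √a) ^ 2) l (𝓝 0) := by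
    refine squeeze_zero' (Eventually.of_forall fun r => sq_nonneg _) ?_ h
    filter_upwards [hX] with r hr
    exact sq_sqrt_sub_sqrt_le_relEntropy ha hr
  have h2 : Tendsto (fun r => √(X r) - √a) l (𝓝 0) := by
    have := h1.sqrt
    simp only [Real.sqrt_sq_eq_abs, Real.sqrt_zero] at this
    exact (tendsto_zero_iff_abs_tendsto_zero _).2 this
  have h3 : Tendsto (fun r => (√(X r) - √a + √a) ^ 2) l (𝓝 ((0 + √a) ^ 2)) :=
    (h2.add_const _).pow 2
  rw [zero_add, Real.sq_sqrt ha.le] at h3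
  refine h3.congr' ?_
  filter_upwards [hX] with r hr
  rw [sub_add_cancel, Real.sq_sqrt hr.le]

/-- `X` and `Z` are positive solutions on `s` of the Lotka–Volterra system
`r X' = X ((Z - (n - p)) / (p - 1) - X)`, `r Z' = Z (n + σ - m X - Z)`. -/
structure LotkaVolterra (n p m σ : ℝ) (s : Set ℝ) (X Z : ℝ → ℝ) : Prop where
  pos : ∀ r ∈ s, 0 < r
  X_pos : ∀ r ∈ s, 0 < X r
  Z_pos : ∀ r ∈ s, 0 < Z r
  X_deriv : ∀ r ∈ s, HasDerivAt X (X r * ((Z r - (n - p)) / (p - 1) - X r) / r) r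
  Z_deriv : ∀ r ∈ s, HasDerivAt Z (Z r * (n + σ - m * X r - Z r) / r) r

/-- The Lyapunov function of the Lotka–Volterra system. -/
noncomputable def lyapunov (n p m σ x z : ℝ) : ℝ :=
  m * (p - 1) * relEntropy (theta p m σ) x + relEntropy (zeta n p m σ) z

section System

variable {n p m σ : ℝ} {s : Set ℝ} {X Z : ℝ → ℝ}

lemma lyapunov_nonneg (h : Admissible n p m σ) {x z : ℝ} (hx : 0 < x) (hz : 0 < z) :
    0 ≤ lyapunov n p m σ x z :=
  add_nonneg (mul_nonneg (mul_pos h.m_pos h.sub_one_pos).le (relEntropy_nonneg h.theta_pos hx))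
    (relEntropy_nonneg h.zeta_pos hz)

/-- The speed at which the Lyapunov function decreases along the flow. -/
lemma LotkaVolterra.hasDerivAt_lyapunov (h : Admissible n p m σ)
    (hs : LotkaVolterra n p m σ s X Z) {r : ℝ} (hr : r ∈ s) :
    HasDerivAt (fun r => lyapunov n p m σ (X r) (Z r))
      (-(m * (p - 1) * (X r - theta p m σ) ^ 2 + (Z r - zeta n p m σ) ^ 2) / r) r := by
  have hX := (hasDerivAt_relEntropy h.theta_pos (hs.X_pos r hr)).comp r (hs.X_deriv r hr)
  have hZ := (hasDerivAt_relEntropy h.zeta_pos (hs.Z_pos r hr)).comp r (hs.Z_deriv r hr)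
  have hz := h.zeta_eq
  have hz' : zeta n p m σ = n + σ - m * theta p m σ := rfl
  have h0 := hs.pos r hr
  have hx0 := hs.X_pos r hr
  have hz0 := hs.Z_pos r hr
  have hp := h.sub_one_pos
  refine ((hX.const_mul (m * (p - 1))).add hZ).congr_deriv ?_
  have e1 : n + σ = zeta n p m σ + m * theta p m σ := by linarith
  have e2 : n - p = zeta n p m σ - (p - 1) * theta p m σ := by linarith
  rw [e1, e2]
  field_simp
  ring

lemma LotkaVolterra.antitoneOn_lyapunov (h : Admissible n p m σ)
    (hs : LotkaVolterra n p m σ s X Z) (hc : Convex ℝ s) (ho : IsOpen s) :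
    AntitoneOn (fun r => lyapunov n p m σ (X r) (Z r)) s := by
  refine antitoneOn_of_hasDerivAt_nonpos hc ho (fun r hr => hs.hasDerivAt_lyapunov h hr) ?_
  intro r hr
  have := mul_pos h.m_pos h.sub_one_pos
  exact div_nonpos_of_nonpos_of_nonneg
    (by nlinarith [sq_nonneg (X r - theta p m σ), sq_nonneg (Z r - zeta n p m σ)])
    (hs.pos r hr).le

/-- Where the Lyapunov function is not small, it decreases at a definite speed in `log r`. -/
lemma exists_dissipation_of_le_lyapunov (h : Admissible n p m σ) {η : ℝ} (hη : 0 < η) :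
    ∃ δ > 0, ∀ x z, η ≤ lyapunov n p m σ x z →
      δ ≤ m * (p - 1) * (x - theta p m σ) ^ 2 + (z - zeta n p m σ) ^ 2 := by
  have hb := mul_pos h.m_pos h.sub_one_pos
  have hX : ∀ᶠ x in 𝓝 (theta p m σ), m * (p - 1) * relEntropy (theta p m σ) x < η / 2 := by
    have := ((continuousAt_relEntropy h.theta_pos).tendsto.const_mul (m * (p - 1)))
    rw [relEntropy_self h.theta_pos, mul_zero] at this
    exact this.eventually_lt_const (by linarith)
  have hZ : ∀ᶠ z in 𝓝 (zeta n p m σ), relEntropy (zeta n p m σ) z < η / 2 := by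
    have := (continuousAt_relEntropy h.zeta_pos).tendsto
    rw [relEntropy_self h.zeta_pos] at this
    exact this.eventually_lt_const (by linarith)
  obtain ⟨ε, hε, hX⟩ := Metric.eventually_nhds_iff.1 hX
  obtain ⟨ε', hε', hZ⟩ := Metric.eventually_nhds_iff.1 hZ
  refine ⟨min (m * (p - 1) * ε ^ 2) (ε' ^ 2), by positivity, fun x z hxz => ?_⟩
  by_cases hx : dist x (theta p m σ) < ε
  · have hz : ¬ dist z (zeta n p m σ) < ε' := fun hz => by
      have h1 := hX hx
      have h2 := hZ hz
      unfold lyapunov at hxz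
      linarith
    rw [not_lt, Real.dist_eq] at hz
    have : ε' ^ 2 ≤ (z - zeta n p m σ) ^ 2 := by
      rw [← sq_abs (z - _)]
      exact pow_le_pow_left₀ hε'.le hz 2
    refine (min_le_right _ _).trans ?_
    nlinarith [mul_nonneg hb.le (sq_nonneg (x - theta p m σ))]
  · rw [not_lt, Real.dist_eq] at hx
    have : ε ^ 2 ≤ (x - theta p m σ) ^ 2 := by
      rw [← sq_abs (x - _)]
      exact pow_le_pow_left₀ hε.le hx 2
    refine (min_le_left _ _).trans ?_
    nlinarith [mul_le_mul_of_nonneg_left this hb.le, sq_nonneg (z - zeta n p m σ)]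

/-- Every positive global solution converges to the equilibrium at `∞`. -/
theorem LotkaVolterra.tendsto_atTop (h : Admissible n p m σ)
    (hs : LotkaVolterra n p m σ (Ioi 0) X Z) :
    Tendsto X atTop (𝓝 (theta p m σ)) ∧ Tendsto Z atTop (𝓝 (zeta n p m σ)) := by
  have hb := mul_pos h.m_pos h.sub_one_pos
  have hpos : ∀ r ∈ Ioi (0:ℝ), 0 ≤ lyapunov n p m σ (X r) (Z r) := fun r hr =>
    lyapunov_nonneg h (hs.X_pos r hr) (hs.Z_pos r hr)
  have hanti := hs.antitoneOn_lyapunov h (convex_Ioi 0) isOpen_Ioi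
  have hsmall : ∀ η > 0, ∃ r ∈ Ioi (0:ℝ), lyapunov n p m σ (X r) (Z r) < η := by
    intro η hη
    by_contra! hcon
    obtain ⟨δ, hδ, hdis⟩ := exists_dissipation_of_le_lyapunov h hη
    obtain ⟨r, hr, hr'⟩ := exists_lt_of_mul_deriv_le_near_top le_rfl hδ
      (fun r hr => hs.hasDerivAt_lyapunov h hr) (fun r hr => by
        have := hdis _ _ (hcon r hr)
        have h0 : r ≠ 0 := (hs.pos r hr).ne'
        rw [mul_div_cancel₀ _ h0]
        linarith) 0
    exact absurd (hpos r hr) (not_le.2 hr')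
  have hV : Tendsto (fun r => lyapunov n p m σ (X r) (Z r)) atTop (𝓝 0) := by
    refine tendsto_order.2 ⟨fun c hc => ?_, fun c hc => ?_⟩
    · filter_upwards [eventually_gt_atTop 0] with r hr
      exact hc.trans_le (hpos r hr)
    · obtain ⟨r₀, hr₀, hr₀'⟩ := hsmall c hc
      filter_upwards [eventually_ge_atTop r₀] with r hr
      exact (hanti hr₀ (lt_of_lt_of_le hr₀ hr) hr).trans_lt hr₀'
  have hev : ∀ᶠ r in atTop, 0 < X r ∧ 0 < Z r := by
    filter_upwards [eventually_gt_atTop 0] with r hr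
    exact ⟨hs.X_pos r hr, hs.Z_pos r hr⟩
  constructor
  · refine tendsto_of_relEntropy_tendsto_zero h.theta_pos (hev.mono fun _ h => h.1) ?_
    have := hV.div_const (m * (p - 1))
    rw [zero_div] at this
    refine squeeze_zero' ?_ ?_ this
    · filter_upwards [hev] with r hr
      exact relEntropy_nonneg h.theta_pos hr.1
    · filter_upwards [hev] with r hr
      rw [le_div_iff₀ hb]
      have := relEntropy_nonneg h.zeta_pos hr.2
      unfold lyapunov
      linarith
  · refine tendsto_of_relEntropy_tendsto_zero h.zeta_pos (hev.mono fun _ h => h.2) ?_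
    refine squeeze_zero' ?_ ?_ hV
    · filter_upwards [hev] with r hr
      exact relEntropy_nonneg h.zeta_pos hr.2
    · filter_upwards [hev] with r hr
      have := mul_nonneg hb.le (relEntropy_nonneg h.theta_pos hr.1)
      unfold lyapunov
      linarith

/-- A positive solution along which the Lyapunov function stays bounded as `r → 0+` is the
equilibrium. -/
theorem LotkaVolterra.eq_equilibrium (h : Admissible n p m σ) {R : ℝ}
    (hs : LotkaVolterra n p m σ (Ioo 0 R) X Z) {B : ℝ}
    (hB : ∀ r ∈ Ioo 0 R, lyapunov n p m σ (X r) (Z r) ≤ B) :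
    ∀ r ∈ Ioo 0 R, X r = theta p m σ ∧ Z r = zeta n p m σ := by
  intro r hr
  have hb := mul_pos h.m_pos h.sub_one_pos
  have hanti := hs.antitoneOn_lyapunov h (convex_Ioo 0 R) isOpen_Ioo
  have hle : lyapunov n p m σ (X r) (Z r) ≤ 0 := by
    refine le_of_forall_pos_le_add fun η hη => ?_
    rw [zero_add]
    by_contra! hcon
    obtain ⟨δ, hδ, hdis⟩ := exists_dissipation_of_le_lyapunov h hη
    have hsub : ∀ q ∈ Ioo 0 r, q ∈ Ioo 0 R := fun q hq => ⟨hq.1, hq.2.trans hr.2⟩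
    obtain ⟨q, hq, hq'⟩ := exists_gt_of_mul_deriv_le_near_zero hr.1 hδ
      (fun q hq => hs.hasDerivAt_lyapunov h (hsub q hq)) (fun q hq => by
        have := hdis (X q) (Z q) (hcon.le.trans (hanti (hsub q hq) hr hq.2.le))
        have h0 : q ≠ 0 := hq.1.ne'
        rw [mul_div_cancel₀ _ h0]
        linarith) B
    exact absurd (hB q (hsub q hq)) (not_le.2 hq')
  have hX := relEntropy_nonneg h.theta_pos (hs.X_pos r hr)
  have hZ := relEntropy_nonneg h.zeta_pos (hs.Z_pos r hr)
  unfold lyapunov at hle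
  have hX' : m * (p - 1) * relEntropy (theta p m σ) (X r) ≤ 0 := by linarith
  constructor
  · refine eq_of_relEntropy_le_zero h.theta_pos (hs.X_pos r hr) ?_
    by_contra! hc
    linarith [mul_pos hb hc]
  · refine eq_of_relEntropy_le_zero h.zeta_pos (hs.Z_pos r hr) ?_
    linarith [mul_nonneg hb.le hX]

lemma lyapunov_le_of_bounds (h : Admissible n p m σ) {c C x z : ℝ} (hc : 0 < c)
    (hx : x ∈ Icc c C) (hz : z ∈ Icc c C) :
    lyapunov n p m σ x z ≤
      m * (p - 1) * (C - theta p m σ - theta p m σ * Real.log (c / theta p m σ))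
      + (C - zeta n p m σ - zeta n p m σ * Real.log (c / zeta n p m σ)) := by
  have key : ∀ a x : ℝ, 0 < a → x ∈ Icc c C →
      relEntropy a x ≤ C - a - a * Real.log (c / a) := by
    intro a x ha hx
    have : Real.log (c / a) ≤ Real.log (x / a) :=
      Real.log_le_log (div_pos hc ha) (div_le_div_of_nonneg_right hx.1 ha.le)
    unfold relEntropy
    nlinarith [hx.2, mul_le_mul_of_nonneg_left this ha.le]
  have hb := mul_pos h.m_pos h.sub_one_pos
  exact add_le_add (mul_le_mul_of_nonneg_left (key _ _ h.theta_pos hx) hb.le)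
    (key _ _ h.zeta_pos hz)

end System

/-! ### The radial equation in logarithmic coordinates -/

/-- The logarithmic derivative `r u' / u` of a profile `u`, expressed through `u` and
`W = r ^ (n - 1) u' ^ (p - 1)`. -/
noncomputable def logSlope (n p : ℝ) (u W : ℝ → ℝ) (r : ℝ) : ℝ :=
  Real.exp ((1 - (n - 1) / (p - 1)) * Real.log r + Real.log (W r) / (p - 1) - Real.log (u r))

/-- The logarithmic derivative `r W' / W` of `W = r ^ (n - 1) u' ^ (p - 1)`, where
`W' = r ^ (n - 1 + σ) / u ^ m`. -/
noncomputable def logFluxSlope (n m σ : ℝ) (u W : ℝ → ℝ) (r : ℝ) : ℝ :=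
  Real.exp ((n + σ) * Real.log r - m * Real.log (u r) - Real.log (W r))

/-- `u` is a positive increasing solution on `s` of the radial equation
`(r ^ (n - 1) u' ^ (p - 1))' = r ^ (n - 1 + σ) / u ^ m` satisfied by `u = 1 - v`, and `W` is the
bracket on the left. The two first order equations are recorded in logarithmic form. -/
structure ProfileSolution (n p m σ : ℝ) (s : Set ℝ) (u W : ℝ → ℝ) : Prop where
  pos : ∀ r ∈ s, 0 < r
  u_pos : ∀ r ∈ s, 0 < u r
  W_pos : ∀ r ∈ s, 0 < W r
  u_deriv : ∀ r ∈ s, HasDerivAt u (u r * logSlope n p u W r / r) r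
  W_deriv : ∀ r ∈ s, HasDerivAt W (W r * logFluxSlope n m σ u W r / r) r

/-- The coefficient of the homogeneous solution `A r ^ θ`. -/
noncomputable def amplitude (n p m σ : ℝ) : ℝ :=
  Real.exp (-(Real.log (zeta n p m σ) + (p - 1) * Real.log (theta p m σ)) / (m + p - 1))

section Profile

variable {n p m σ : ℝ} {s : Set ℝ} {u W : ℝ → ℝ}

lemma amplitude_pos : 0 < amplitude n p m σ := Real.exp_pos _

lemma mul_logSlope_div (hp : 1 < p) {r : ℝ} (hr : 0 < r) (hu : 0 < u r) (hW : 0 < W r) :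
    u r * logSlope n p u W r / r = (r ^ (1 - n) * W r) ^ (1 / (p - 1)) := by
  have hp' : p - 1 ≠ 0 := by linarith
  have h1 : (0:ℝ) < r ^ (1 - n) * W r := by positivity
  rw [Real.rpow_def_of_pos h1, Real.log_mul (by positivity) hW.ne', Real.log_rpow hr]
  conv_lhs => rw [← Real.exp_log hu, ← Real.exp_log hr]
  unfold logSlope
  rw [Real.exp_log hr, Real.exp_log hu]
  conv_lhs => rw [← Real.exp_log hu, ← Real.exp_add]
  conv_lhs =>
    enter [2]
    rw [← Real.exp_log hr]
  rw [← Real.exp_sub]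
  simp only [Real.log_exp]
  congr 1
  field_simp
  ring

lemma mul_logFluxSlope_div {r : ℝ} (hr : 0 < r) (hu : 0 < u r) (hW : 0 < W r) :
    W r * logFluxSlope n m σ u W r / r = r ^ (n - 1 + σ) * u r ^ (-m) := by
  rw [Real.rpow_def_of_pos hr, Real.rpow_def_of_pos hu, ← Real.exp_add]
  unfold logFluxSlope
  conv_lhs =>
    enter [1, 1]
    rw [← Real.exp_log hW]
  conv_lhs =>
    enter [2]
    rw [← Real.exp_log hr]
  rw [← Real.exp_add, ← Real.exp_sub]
  congr 1
  ring

lemma ProfileSolution.of_rpow (hp : 1 < p) (pos : ∀ r ∈ s, 0 < r) (hu : ∀ r ∈ s, 0 < u r)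
    (hW : ∀ r ∈ s, 0 < W r)
    (hu' : ∀ r ∈ s, HasDerivAt u ((r ^ (1 - n) * W r) ^ (1 / (p - 1))) r)
    (hW' : ∀ r ∈ s, HasDerivAt W (r ^ (n - 1 + σ) * u r ^ (-m)) r) :
    ProfileSolution n p m σ s u W where
  pos := pos
  u_pos := hu
  W_pos := hW
  u_deriv r hr := by
    rw [mul_logSlope_div hp (pos r hr) (hu r hr) (hW r hr)]
    exact hu' r hr
  W_deriv r hr := by
    rw [mul_logFluxSlope_div (pos r hr) (hu r hr) (hW r hr)]
    exact hW' r hr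

lemma ProfileSolution.mono {t : Set ℝ} (hs : ProfileSolution n p m σ s u W) (hts : t ⊆ s) :
    ProfileSolution n p m σ t u W where
  pos r hr := hs.pos r (hts hr)
  u_pos r hr := hs.u_pos r (hts hr)
  W_pos r hr := hs.W_pos r (hts hr)
  u_deriv r hr := hs.u_deriv r (hts hr)
  W_deriv r hr := hs.W_deriv r (hts hr)

lemma ProfileSolution.hasDerivAt_u (hp : 1 < p) (hs : ProfileSolution n p m σ s u W) {r : ℝ}
    (hr : r ∈ s) : HasDerivAt u ((r ^ (1 - n) * W r) ^ (1 / (p - 1))) r := by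
  rw [← mul_logSlope_div hp (hs.pos r hr) (hs.u_pos r hr) (hs.W_pos r hr)]
  exact hs.u_deriv r hr

lemma ProfileSolution.hasDerivAt_W (hs : ProfileSolution n p m σ s u W) {r : ℝ}
    (hr : r ∈ s) : HasDerivAt W (r ^ (n - 1 + σ) * u r ^ (-m)) r := by
  rw [← mul_logFluxSlope_div (hs.pos r hr) (hs.u_pos r hr) (hs.W_pos r hr)]
  exact hs.W_deriv r hr

/-- In logarithmic coordinates the radial equation is a Lotka–Volterra system. -/
theorem ProfileSolution.lotkaVolterra (hp : 1 < p) (hs : ProfileSolution n p m σ s u W) :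
    LotkaVolterra n p m σ s (logSlope n p u W) (logFluxSlope n m σ u W) where
  pos := hs.pos
  X_pos r _ := Real.exp_pos _
  Z_pos r _ := Real.exp_pos _
  X_deriv r hr := by
    have h0 := hs.pos r hr
    have hu := hs.u_pos r hr
    have hW := hs.W_pos r hr
    have hp' : p - 1 ≠ 0 := by linarith
    have h1 := (Real.hasDerivAt_log h0.ne').const_mul (1 - (n - 1) / (p - 1))
    have h2 := ((hs.W_deriv r hr).log hW.ne').div_const (p - 1)
    have h3 := (hs.u_deriv r hr).log hu.ne'
    refine ((h1.add h2).sub h3).exp.congr_deriv ?_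
    change logSlope n p u W r * _ = _
    field_simp
    ring
  Z_deriv r hr := by
    have h0 := hs.pos r hr
    have hu := hs.u_pos r hr
    have hW := hs.W_pos r hr
    have h1 := (Real.hasDerivAt_log h0.ne').const_mul (n + σ)
    have h2 := (hs.W_deriv r hr).log hW.ne'
    have h3 := ((hs.u_deriv r hr).log hu.ne').const_mul m
    refine ((h1.sub h3).sub h2).exp.congr_deriv ?_
    change logFluxSlope n m σ u W r * _ = _
    field_simp

lemma log_logFluxSlope_add (hp : 1 < p) (r : ℝ) :
    Real.log (logFluxSlope n m σ u W r) + (p - 1) * Real.log (logSlope n p u W r) =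
      (p + σ) * Real.log r - (m + p - 1) * Real.log (u r) := by
  have hp' : p - 1 ≠ 0 := by linarith
  unfold logFluxSlope logSlope
  rw [Real.log_exp, Real.log_exp]
  field_simp
  ring

/-- The profile is recovered from its logarithmic coordinates. -/
lemma ProfileSolution.eq_rpow_mul (h : Admissible n p m σ)
    (hs : ProfileSolution n p m σ s u W) {r : ℝ} (hr : r ∈ s) :
    u r = r ^ theta p m σ * Real.exp (-(Real.log (logFluxSlope n m σ u W r) +
      (p - 1) * Real.log (logSlope n p u W r)) / (m + p - 1)) := by
  rw [log_logFluxSlope_add (by linarith [h.two_le]), Real.rpow_def_of_pos (hs.pos r hr),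
    ← Real.exp_add]
  conv_lhs => rw [← Real.exp_log (hs.u_pos r hr)]
  congr 1
  have := h.exp_pos.ne'
  unfold theta
  field_simp
  ring

/-! ### Asymptotics at infinity -/

theorem ProfileSolution.tendsto_div_rpow (h : Admissible n p m σ)
    (hs : ProfileSolution n p m σ (Ioi 0) u W) :
    Tendsto (fun r => u r / r ^ theta p m σ) atTop (𝓝 (amplitude n p m σ)) := by
  obtain ⟨hX, hZ⟩ := (hs.lotkaVolterra (by linarith [h.two_le])).tendsto_atTop h
  have h1 := ((((hZ.log h.zeta_pos.ne').add ((hX.log h.theta_pos.ne').const_mul (p - 1))).neg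
    ).div_const (m + p - 1))
  refine ((Real.continuous_exp.tendsto _).comp h1).congr' ?_
  filter_upwards [eventually_gt_atTop 0] with r hr
  have h0 : r ^ theta p m σ ≠ 0 := (Real.rpow_pos_of_pos hr _).ne'
  rw [eq_div_iff h0, mul_comm, hs.eq_rpow_mul h hr]
  rfl

lemma ProfileSolution.hasDerivAt_deriv (hp : 1 < p) (ho : IsOpen s)
    (hs : ProfileSolution n p m σ s u W) {r : ℝ} (hr : r ∈ s) :
    HasDerivAt (deriv u) (u r / r ^ 2 * (logSlope n p u W r ^ 2 + logSlope n p u W r *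
      ((logFluxSlope n m σ u W r - (n - p)) / (p - 1) - logSlope n p u W r)
      - logSlope n p u W r)) r := by
  have h0 := hs.pos r hr
  have h1 := ((hs.u_deriv r hr).mul ((hs.lotkaVolterra hp).X_deriv r hr)).div
    (hasDerivAt_id' r) h0.ne'
  have h2 : deriv u =ᶠ[𝓝 r] fun r => u r * logSlope n p u W r / r := by
    filter_upwards [ho.mem_nhds hr] with q hq
    exact (hs.u_deriv q hq).deriv
  refine (HasDerivAt.congr_deriv h1 ?_).congr_of_eventuallyEq h2
  simp only [Pi.mul_apply]
  field_simp

lemma ProfileSolution.contDiffOn (hp : 1 < p) (ho : IsOpen s)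
    (hs : ProfileSolution n p m σ s u W) : ContDiffOn ℝ 2 u s := by
  have hcX : ContinuousOn (logSlope n p u W) s := fun r hr =>
    ((hs.lotkaVolterra hp).X_deriv r hr).continuousAt.continuousWithinAt
  have hcZ : ContinuousOn (logFluxSlope n m σ u W) s := fun r hr =>
    ((hs.lotkaVolterra hp).Z_deriv r hr).continuousAt.continuousWithinAt
  have hcu : ContinuousOn u s := fun r hr =>
    (hs.u_deriv r hr).continuousAt.continuousWithinAt
  rw [show (2 : WithTop ℕ∞) = 1 + 1 by norm_num, contDiffOn_succ_iff_deriv_of_isOpen ho]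
  refine ⟨fun r hr => (hs.u_deriv r hr).differentiableAt.differentiableWithinAt, by simp, ?_⟩
  rw [show (1 : WithTop ℕ∞) = 0 + 1 by norm_num, contDiffOn_succ_iff_deriv_of_isOpen ho]
  refine ⟨fun r hr => (hs.hasDerivAt_deriv hp ho hr).differentiableAt.differentiableWithinAt,
    by simp, ?_⟩
  rw [contDiffOn_zero]
  refine ContinuousOn.congr (f := fun r => u r / r ^ 2 * (logSlope n p u W r ^ 2 +
    logSlope n p u W r * ((logFluxSlope n m σ u W r - (n - p)) / (p - 1) - logSlope n p u W r)
      - logSlope n p u W r)) ?_ (fun r hr => (hs.hasDerivAt_deriv hp ho hr).deriv)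
  have : ∀ r ∈ s, r ^ 2 ≠ 0 := fun r hr => (pow_pos (hs.pos r hr) 2).ne'
  fun_prop (disch := assumption)

theorem ProfileSolution.tendsto_deriv_div_rpow (h : Admissible n p m σ)
    (hs : ProfileSolution n p m σ (Ioi 0) u W) :
    Tendsto (fun r => deriv u r / r ^ (theta p m σ - 1)) atTop
      (𝓝 (amplitude n p m σ * theta p m σ)) := by
  obtain ⟨hX, hZ⟩ := (hs.lotkaVolterra (by linarith [h.two_le])).tendsto_atTop h
  refine ((hs.tendsto_div_rpow h).mul hX).congr' ?_
  filter_upwards [eventually_gt_atTop 0] with r hr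
  have h0 : r ^ theta p m σ ≠ 0 := (Real.rpow_pos_of_pos hr _).ne'
  have hr' : r ≠ 0 := (mem_Ioi.1 hr).ne'
  rw [(hs.u_deriv r hr).deriv, Real.rpow_sub_one hr']
  field_simp

theorem ProfileSolution.tendsto_deriv_deriv_div_rpow (h : Admissible n p m σ)
    (hs : ProfileSolution n p m σ (Ioi 0) u W) :
    Tendsto (fun r => deriv (deriv u) r / r ^ (theta p m σ - 1 - 1)) atTop
      (𝓝 (amplitude n p m σ * theta p m σ * (theta p m σ - 1))) := by
  have hp : 1 < p := by linarith [h.two_le]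
  obtain ⟨hX, hZ⟩ := (hs.lotkaVolterra hp).tendsto_atTop h
  have h1 := (hs.tendsto_div_rpow h).mul (((hX.pow 2).add (hX.mul
    (((hZ.sub_const (n - p)).div_const (p - 1)).sub hX))).sub hX)
  have e : (zeta n p m σ - (n - p)) / (p - 1) - theta p m σ = 0 := by
    rw [h.zeta_eq]
    have := h.sub_one_pos.ne'
    field_simp
    ring
  rw [e] at h1
  have e2 : amplitude n p m σ * (theta p m σ ^ 2 + theta p m σ * 0 - theta p m σ) =
    amplitude n p m σ * theta p m σ * (theta p m σ - 1) := by ring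
  rw [e2] at h1
  refine h1.congr' ?_
  filter_upwards [eventually_gt_atTop 0] with r hr
  have h0 : r ^ theta p m σ ≠ 0 := (Real.rpow_pos_of_pos hr _).ne'
  have hr' : r ≠ 0 := (mem_Ioi.1 hr).ne'
  rw [(hs.hasDerivAt_deriv hp isOpen_Ioi hr).deriv, Real.rpow_sub_one hr', Real.rpow_sub_one hr']
  field_simp

/-! ### Oscillation around the homogeneous solution -/

/-- If the linearisation at the equilibrium has non-real eigenvalues, an entire profile meets
the homogeneous solution at arbitrarily large radii. With `y = log (u / (A r ^ θ))`, the quotient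
`q = r y' / y` would otherwise satisfy, for large `r`, a Riccati equation
`r q' = -(q ^ 2 + a q + b)` with `a ^ 2 < 4 b`, and `arctan q` would tend to `-∞`. -/
theorem ProfileSolution.exists_eq_amplitude_mul_rpow (h : Admissible n p m σ)
    (hs : ProfileSolution n p m σ (Ioi 0) u W)
    (hosc : (theta p m σ + zeta n p m σ) ^ 2 <
      4 * (theta p m σ * zeta n p m σ * (m + p - 1) / (p - 1))) (S : ℝ) :
    ∃ r > S, 0 < r ∧ u r = amplitude n p m σ * r ^ theta p m σ := by
  by_contra! hcon
  have hp : 1 < p := by linarith [h.two_le]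
  have hp1 := h.sub_one_pos
  have hK := h.exp_pos
  have hθ := h.theta_pos
  have hζ := h.zeta_pos
  have hLV := hs.lotkaVolterra hp
  obtain ⟨hX, hZ⟩ := hLV.tendsto_atTop h
  set X := logSlope n p u W with hXdef
  set Z := logFluxSlope n m σ u W with hZdef
  set θ := theta p m σ with hθdef
  set ζ := zeta n p m σ with hζdef
  set A := amplitude n p m σ with hAdef
  -- the difference quotients of `exp` and `log` turn the system into a linear one with
  -- coefficients converging at infinity
  set E : ℝ → ℝ := fun r => dslope Real.exp (Real.log ζ) (Real.log (Z r)) with hE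
  set L : ℝ → ℝ := fun r => dslope Real.log θ (X r) with hL
  have hElim : Tendsto E atTop (𝓝 ζ) := by
    have h1 : ContinuousAt (dslope Real.exp (Real.log ζ)) (Real.log ζ) :=
      continuousAt_dslope_same.2 Real.differentiableAt_exp
    have h2 := h1.tendsto.comp (hZ.log hζ.ne')
    rwa [dslope_same, Real.deriv_exp, Real.exp_log hζ] at h2
  have hLlim : Tendsto L atTop (𝓝 θ⁻¹) := by
    have h1 : ContinuousAt (dslope Real.log θ) θ :=
      continuousAt_dslope_same.2 (Real.differentiableAt_log hθ.ne')
    have h2 := h1.tendsto.comp hX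
    rwa [dslope_same, Real.deriv_log] at h2
  set a : ℝ → ℝ := fun r => X r + X r * E r * L r with ha
  set b : ℝ → ℝ := fun r => X r * E r * (m + p - 1) / (p - 1) with hb
  have halim : Tendsto a atTop (𝓝 (θ + ζ)) := by
    have := hX.add ((hX.mul hElim).mul hLlim)
    have e : θ + θ * ζ * θ⁻¹ = θ + ζ := by field_simp
    rwa [e] at this
  have hblim : Tendsto b atTop (𝓝 (θ * ζ * (m + p - 1) / (p - 1))) :=
    ((hX.mul hElim).mul_const _).div_const _
  obtain ⟨δ, hδ0, hδ1, hδ⟩ : ∃ δ : ℝ, 0 < δ ∧ δ < 1 ∧ (θ + ζ) ^ 2 <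
      4 * (1 - δ) * (θ * ζ * (m + p - 1) / (p - 1) - δ) := by
    have hcont : Tendsto (fun δ : ℝ => 4 * (1 - δ) * (θ * ζ * (m + p - 1) / (p - 1) - δ))
        (𝓝[>] 0) (𝓝 (4 * (1 - 0) * (θ * ζ * (m + p - 1) / (p - 1) - 0))) := by
      refine Tendsto.mono_left (Continuous.tendsto ?_ 0) nhdsWithin_le_nhds
      fun_prop
    have hlt := hcont.eventually_const_lt (u := (θ + ζ) ^ 2) (by linarith)
    have hev : ∀ᶠ δ in 𝓝[>] (0 : ℝ), δ ∈ Ioo (0:ℝ) 1 := Ioo_mem_nhdsGT one_pos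
    obtain ⟨δ, h1, h2⟩ := (hev.and hlt).exists
    exact ⟨δ, h1.1, h1.2, h2⟩
  have hquad : ∀ᶠ r in atTop, a r ^ 2 < 4 * (1 - δ) * (b r - δ) :=
    (halim.pow 2).eventually_lt ((hblim.sub_const δ).const_mul _) hδ
  obtain ⟨T, hT⟩ := eventually_atTop.1 hquad
  set R := max 0 (max S T) with hR
  have hR0 : 0 ≤ R := le_max_left _ _
  have hRr : ∀ r ∈ Ioi R, 0 < r ∧ S < r ∧ T < r := fun r hr =>
    ⟨(le_max_left _ _).trans_lt hr,
      ((le_max_left _ _).trans (le_max_right _ _)).trans_lt hr,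
      ((le_max_right _ _).trans (le_max_right _ _)).trans_lt hr⟩
  set y : ℝ → ℝ := fun r => Real.log (u r) - θ * Real.log r - Real.log A with hy
  have hA : 0 < A := amplitude_pos
  have hy0 : ∀ r ∈ Ioi R, y r ≠ 0 := by
    intro r hr h0
    obtain ⟨hr0, hrS, -⟩ := hRr r hr
    refine hcon r hrS hr0 ?_
    rw [← Real.exp_log (hs.u_pos r hr0), Real.rpow_def_of_pos hr0]
    conv_rhs => rw [← Real.exp_log hA, ← Real.exp_add]
    congr 1
    simp only [hy] at h0
    linarith
  have hy' : ∀ r ∈ Ioi R, HasDerivAt y ((X r - θ) / r) r := by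
    intro r hr
    have hr0 := (hRr r hr).1
    have hu := hs.u_pos r hr0
    refine ((((hs.u_deriv r hr0).log hu.ne').sub
      ((Real.hasDerivAt_log hr0.ne').const_mul θ)).sub_const _).congr_deriv ?_
    rw [← hXdef]
    field_simp
  have hZX : ∀ r ∈ Ioi R, Z r - ζ = E r * (-(m + p - 1) * y r - (p - 1) * ((X r - θ) * L r)) := by
    intro r hr
    have hr0 := (hRr r hr).1
    have h1 := sub_smul_dslope Real.exp (Real.log ζ) (Real.log (Z r))
    have h2 := sub_smul_dslope Real.log θ (X r)
    rw [Real.exp_log hζ, Real.exp_log (hLV.Z_pos r hr0), smul_eq_mul] at h1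
    rw [smul_eq_mul] at h2
    have h3 : Real.log (Z r) + (p - 1) * Real.log (X r) =
      (p + σ) * Real.log r - (m + p - 1) * Real.log (u r) := log_logFluxSlope_add hp r
    have h4 : Real.log A * (m + p - 1) = -(Real.log ζ + (p - 1) * Real.log θ) := by
      rw [hAdef, amplitude, Real.log_exp]
      field_simp
      rfl
    have h5 : (m + p - 1) * θ = p + σ := h.exp_mul_theta
    have h6 : Real.log (Z r) - Real.log ζ =
        -(m + p - 1) * y r - (p - 1) * ((X r - θ) * L r) := by
      simp only [hL, h2, hy]
      linear_combination h3 - h4 - Real.log r * h5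
    rw [← h1, h6, mul_comm]
  have hq : ∀ r ∈ Ioi R, HasDerivAt (fun r => Real.arctan ((X r - θ) / y r))
      (1 / (1 + ((X r - θ) / y r) ^ 2) *
        (-(((X r - θ) / y r) ^ 2 + a r * ((X r - θ) / y r) + b r) / r)) r := by
    intro r hr
    have hr0 := (hRr r hr).1
    have hyr := hy0 r hr
    have h1 := ((hLV.X_deriv r hr0).sub_const θ).div (hy' r hr) hyr
    refine (HasDerivAt.congr_deriv h1 ?_).arctan
    have e1 : Z r - (n - p) = (Z r - ζ) + (p - 1) * θ := by
      have : ζ = n - p + (p - 1) * θ := h.zeta_eq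
      linarith
    rw [e1, hZX r hr]
    simp only [ha, hb]
    field_simp
    ring
  obtain ⟨r, hr, hr'⟩ := exists_lt_of_mul_deriv_le_near_top hR0 hδ0 hq (fun r hr => by
    have hr0 := (hRr r hr).1
    have hlt := hT r (hRr r hr).2.2.le
    generalize (X r - θ) / y r = q
    have h1 : 0 < 1 + q ^ 2 := by positivity
    have h2 : δ * (1 + q ^ 2) ≤ q ^ 2 + a r * q + b r := by
      have hδ' : 0 < 1 - δ := by linarith
      have h3 : 0 ≤ 4 * (1 - δ) * (q ^ 2 + a r * q + b r - δ * (1 + q ^ 2)) := by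
        nlinarith [sq_nonneg (2 * (1 - δ) * q + a r)]
      by_contra! hc
      have : 4 * (1 - δ) * (q ^ 2 + a r * q + b r - δ * (1 + q ^ 2)) < 0 :=
        mul_neg_of_pos_of_neg (by linarith) (by linarith)
      linarith
    have e : r * (1 / (1 + q ^ 2) * (-(q ^ 2 + a r * q + b r) / r)) =
        -((q ^ 2 + a r * q + b r) / (1 + q ^ 2)) := by
      field_simp
    rw [e, neg_le_neg_iff, le_div_iff₀ h1]
    exact h2) (-(Real.pi / 2))
  exact absurd (Real.neg_pi_div_two_lt_arctan _) (not_lt.2 hr'.le)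

end Profile

/-! ### Differential operators on radial functions -/

section Radial

variable {N : ℕ}

lemma hasFDerivAt_norm_of_ne_zero {x : Space N} (hx : x ≠ 0) :
    HasFDerivAt (fun x : Space N => ‖x‖) (‖x‖⁻¹ • innerSL ℝ x) x := by
  have h1 := (hasStrictFDerivAt_norm_sq x).hasFDerivAt
  have hx' : 0 < ‖x‖ := norm_pos_iff.2 hx
  have h2 := h1.sqrt (pow_pos hx' 2).ne'
  simp only [Real.sqrt_sq (norm_nonneg _)] at h2
  refine h2.congr_fderiv ?_
  ext y
  simp
  field_simp

lemma hasGradientAt_radial {w : ℝ → ℝ} {w' : ℝ} {x : Space N} (hx : x ≠ 0)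
    (hw : HasDerivAt w w' ‖x‖) : HasGradientAt (radial N w) ((w' / ‖x‖) • x) x := by
  rw [hasGradientAt_iff_hasFDerivAt]
  refine (hw.comp_hasFDerivAt x (hasFDerivAt_norm_of_ne_zero hx)).congr_fderiv ?_
  ext y
  simp [div_eq_mul_inv, mul_assoc]

lemma pFlux_radial {p : ℝ} {w : ℝ → ℝ} {w' : ℝ} {x : Space N} (hx : x ≠ 0)
    (hw : HasDerivAt w w' ‖x‖) :
    pFlux p (radial N w) x = (|w'| ^ (p - 2) * w' / ‖x‖) • x := by
  have hx' : ‖x‖ ≠ 0 := norm_ne_zero_iff.2 hx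
  unfold pFlux
  rw [(hasGradientAt_radial hx hw).gradient, norm_smul, norm_div, norm_norm,
    div_mul_cancel₀ _ hx', smul_smul, Real.norm_eq_abs, mul_div_assoc]

lemma hasFDerivAt_smul_radial {g : ℝ → ℝ} {g' : ℝ} {x : Space N} (hx : x ≠ 0)
    (hg : HasDerivAt g g' ‖x‖) :
    HasFDerivAt (fun x : Space N => g ‖x‖ • x)
      (g ‖x‖ • ContinuousLinearMap.id ℝ (Space N) +
        (g' • (‖x‖⁻¹ • innerSL ℝ x)).smulRight x) x :=
  (hg.comp_hasFDerivAt x (hasFDerivAt_norm_of_ne_zero hx)).smul (hasFDerivAt_id x)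

lemma divergence_eq_of_hasFDerivAt_smul_id {F : Space N → Space N} {c : ℝ} {x : Space N}
    (hF : HasFDerivAt F (c • ContinuousLinearMap.id ℝ (Space N)) x) :
    divergence F x = N * c := by
  unfold divergence
  rw [hF.fderiv]
  simp

lemma divergence_smul_radial {F : Space N → Space N} {g : ℝ → ℝ} {g' : ℝ} {x : Space N}
    (hx : x ≠ 0) (hg : HasDerivAt g g' ‖x‖) (hF : F =ᶠ[𝓝 x] fun x => g ‖x‖ • x) :
    divergence F x = g' * ‖x‖ + N * g ‖x‖ := by
  have hx' : ‖x‖ ≠ 0 := norm_ne_zero_iff.2 hx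
  unfold divergence
  rw [((hasFDerivAt_smul_radial hx hg).congr_of_eventuallyEq hF).fderiv]
  have h1 : ∑ i : Fin N, x i * x i = ‖x‖ ^ 2 := by
    rw [EuclideanSpace.norm_sq_eq]
    simp [sq]
  have h2 : ∀ i : Fin N, inner ℝ x (EuclideanSpace.single i (1:ℝ)) = x i := by
    intro i
    rw [EuclideanSpace.inner_single_right]
    simp
  simp [h2, Finset.sum_add_distrib, mul_assoc, ← Finset.mul_sum, h1]
  field_simp
  ring

lemma exists_norm_eq_one_of_pos (hN : 0 < N) : ∃ e : Space N, ‖e‖ = 1 :=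
  ⟨EuclideanSpace.single ⟨0, hN⟩ 1, by simp⟩

end Radial

/-! ### Profiles give solutions -/

section ToPDE

variable {N : ℕ} {p m σ R : ℝ} {u W : ℝ → ℝ}

/-- The flux of a radial solution. -/
lemma ProfileSolution.pFlux_eq (hp : 1 < p) (hs : ProfileSolution N p m σ (Ioo 0 R) u W)
    {x : Space N} (hx : x ≠ 0) (hxR : ‖x‖ < R) :
    pFlux p (radial N fun r => 1 - u r) x = (-(‖x‖ ^ (-(N:ℝ)) * W ‖x‖)) • x := by
  have h0 : 0 < ‖x‖ := norm_pos_iff.2 hx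
  have hr : ‖x‖ ∈ Ioo 0 R := ⟨h0, hxR⟩
  rw [pFlux_radial hx ((hs.hasDerivAt_u hp hr).const_sub 1)]
  congr 1
  have hW := hs.W_pos _ hr
  have hb : 0 < ‖x‖ ^ (1 - (N:ℝ)) * W ‖x‖ := by positivity
  have hp' : p - 1 ≠ 0 := by linarith
  have hq : 0 < (‖x‖ ^ (1 - (N:ℝ)) * W ‖x‖) ^ (1 / (p - 1)) := Real.rpow_pos_of_pos hb _
  rw [abs_neg, abs_of_pos hq]
  have h1 : ((‖x‖ ^ (1 - (N:ℝ)) * W ‖x‖) ^ (1 / (p - 1))) ^ (p - 2) *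
      (‖x‖ ^ (1 - (N:ℝ)) * W ‖x‖) ^ (1 / (p - 1)) = ‖x‖ ^ (1 - (N:ℝ)) * W ‖x‖ := by
    conv_lhs =>
      enter [2]
      rw [← Real.rpow_one ((‖x‖ ^ (1 - (N:ℝ)) * W ‖x‖) ^ (1 / (p - 1)))]
    rw [← Real.rpow_add hq, ← Real.rpow_mul hb.le]
    have : 1 / (p - 1) * (p - 2 + 1) = 1 := by
      field_simp
      ring
    rw [this, Real.rpow_one]
  rw [mul_neg, h1, sub_eq_add_neg, Real.rpow_add h0, Real.rpow_one]
  field_simp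

lemma ProfileSolution.hasDerivAt_flux (hs : ProfileSolution N p m σ (Ioo 0 R) u W)
    {r : ℝ} (hr : r ∈ Ioo 0 R) :
    HasDerivAt (fun r => -(r ^ (-(N:ℝ)) * W r))
      ((N * (r ^ (-(N:ℝ)) * W r) - r ^ σ * u r ^ (-m)) / r) r := by
  have h0 := hr.1
  refine ((((hasDerivAt_id' r).rpow_const (p := -(N:ℝ)) (Or.inl h0.ne')).mul
    (hs.hasDerivAt_W hr)).neg).congr_deriv ?_
  have e1 : r ^ (-(N:ℝ)) * r ^ ((N:ℝ) - 1 + σ) = r ^ σ / r := by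
    rw [← Real.rpow_add h0, ← Real.rpow_sub_one h0.ne']
    congr 1
    ring
  rw [Real.rpow_sub_one h0.ne', eq_div_iff h0.ne']
  have e2 : r ^ (-(N:ℝ)) * (r ^ ((N:ℝ) - 1 + σ) * u r ^ (-m)) = r ^ σ / r * u r ^ (-m) := by
    rw [← mul_assoc, e1]
  rw [e2]
  field_simp
  ring

theorem ProfileSolution.solves_punctured (hp : 1 < p)
    (hs : ProfileSolution N p m σ (Ioo 0 R) u W) :
    Solves p σ m (Metric.ball (0 : Space N) R \ {0}) (radial N fun r => 1 - u r) := by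
  have hopen : IsOpen (Metric.ball (0 : Space N) R \ {0}) :=
    Metric.isOpen_ball.sdiff isClosed_singleton
  have hmem : ∀ x ∈ Metric.ball (0 : Space N) R \ {0}, x ≠ 0 ∧ ‖x‖ < R ∧ ‖x‖ ∈ Ioo 0 R := by
    rintro x ⟨h1, h2⟩
    rw [mem_ball_zero_iff] at h1
    exact ⟨h2, h1, norm_pos_iff.2 h2, h1⟩
  have hflux : ∀ x ∈ Metric.ball (0 : Space N) R \ {0},
      pFlux p (radial N fun r => 1 - u r) =ᶠ[𝓝 x] fun x => (-(‖x‖ ^ (-(N:ℝ)) * W ‖x‖)) • x := by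
    intro x hx
    filter_upwards [hopen.mem_nhds hx] with y hy
    exact hs.pFlux_eq hp (hmem y hy).1 (hmem y hy).2.1
  refine ⟨?_, ?_, ?_, ?_⟩
  · intro x hx
    obtain ⟨h0, -, hr⟩ := hmem x hx
    have h1 : ContDiffAt ℝ 1 (fun r => 1 - u r) ‖x‖ :=
      contDiffAt_const.sub (((hs.contDiffOn hp isOpen_Ioo).of_le (by norm_num)).contDiffAt
        (isOpen_Ioo.mem_nhds hr))
    exact (h1.comp x (contDiffAt_norm ℝ h0)).contDiffWithinAt
  · intro x hx
    obtain ⟨h0, -, hr⟩ := hmem x hx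
    exact ((hasFDerivAt_smul_radial h0 (hs.hasDerivAt_flux hr)).congr_of_eventuallyEq
      (hflux x hx)).differentiableAt.differentiableWithinAt
  · intro x hx
    have := hs.u_pos _ (hmem x hx).2.2
    simp only [radial]
    linarith
  · intro x hx
    obtain ⟨h0, -, hr⟩ := hmem x hx
    have hu := hs.u_pos _ hr
    have hr0 : ‖x‖ ≠ 0 := hr.1.ne'
    unfold pLaplacian
    rw [divergence_smul_radial h0 (hs.hasDerivAt_flux hr) (hflux x hx)]
    simp only [radial]
    rw [sub_sub_cancel, Real.rpow_neg hu.le]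
    field_simp
    ring

/-- The flux of a profile that starts at `α > 0`. -/
lemma ProfileSolution.tendsto_W_div_rpow {n : ℝ} (hn : 0 < n + σ) (hR : 0 < R) {α : ℝ}
    (hα : 0 < α) (hs : ProfileSolution n p m σ (Ioo 0 R) u W)
    (hu : Tendsto u (𝓝[>] 0) (𝓝 α)) (hW : Tendsto W (𝓝[>] 0) (𝓝 0)) :
    Tendsto (fun r => W r / r ^ (n + σ)) (𝓝[>] 0) (𝓝 (α ^ (-m) / (n + σ))) := by
  have hev : ∀ᶠ r in 𝓝[>] (0:ℝ), r ∈ Ioo 0 R := Ioo_mem_nhdsGT hR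
  refine HasDerivAt.lhopital_zero_nhdsGT (f' := fun r => r ^ (n - 1 + σ) * u r ^ (-m))
    (g' := fun r => (n + σ) * r ^ (n + σ - 1)) ?_ ?_ ?_ hW ?_ ?_
  · filter_upwards [hev] with r hr using hs.hasDerivAt_W hr
  · filter_upwards [hev] with r hr using Real.hasDerivAt_rpow_const (Or.inl hr.1.ne')
  · filter_upwards [hev] with r hr
    exact (mul_pos hn (Real.rpow_pos_of_pos hr.1 _)).ne'
  · have := (Real.continuousAt_rpow_const 0 (n + σ) (Or.inr hn.le)).tendsto
    rw [Real.zero_rpow hn.ne'] at this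
    exact this.mono_left nhdsWithin_le_nhds
  · refine ((hu.rpow_const (Or.inl hα.ne') (p := -m)).div_const (n + σ)).congr' ?_
    filter_upwards [hev] with r hr
    have : r ^ (n - 1 + σ) = r ^ (n + σ - 1) := by congr 1; ring
    have h2 := (Real.rpow_pos_of_pos hr.1 (n + σ - 1)).ne'
    rw [this]
    field_simp

/-- A profile that starts at a positive value with zero flux gives a solution in the whole
ball. -/
theorem ProfileSolution.solves_ball (hp : 2 ≤ p) (hσ : 0 ≤ σ) (hN : 0 < N) (hR : 0 < R) {α : ℝ}
    (hα : 0 < α) (hs : ProfileSolution N p m σ (Ioo 0 R) u W) (hu0 : u 0 = α)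
    (hu : Tendsto u (𝓝[>] 0) (𝓝 α)) (hW : Tendsto W (𝓝[>] 0) (𝓝 0)) :
    Solves p σ m (Metric.ball (0 : Space N) R) (radial N fun r => 1 - u r) := by
  have hp1 : 1 < p := by linarith
  have hN' : (0:ℝ) < N := by exact_mod_cast hN
  have hNσ : (0:ℝ) < N + σ := by linarith
  have hev : ∀ᶠ r in 𝓝[>] (0:ℝ), r ∈ Ioo 0 R := Ioo_mem_nhdsGT hR
  have hlim := hs.tendsto_W_div_rpow hNσ hR hα hu hW
  have hpun := hs.solves_punctured hp1
  set v := radial N fun r => 1 - u r with hv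
  have hpow : ∀ c : ℝ, 0 ≤ c → Tendsto (fun r : ℝ => r ^ c) (𝓝[>] 0) (𝓝 (0 ^ c)) := fun c hc =>
    ((Real.continuousAt_rpow_const 0 c (Or.inr hc)).tendsto).mono_left nhdsWithin_le_nhds
  -- the slope of the profile vanishes at the origin
  have hslope : Tendsto (fun r => (r ^ (1 - (N:ℝ)) * W r) ^ (1 / (p - 1))) (𝓝[>] 0) (𝓝 0) := by
    have h1 : Tendsto (fun r => r ^ (1 - (N:ℝ)) * W r) (𝓝[>] 0) (𝓝 0) := by
      have := (hpow (1 + σ) (by linarith)).mul hlim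
      rw [Real.zero_rpow (by linarith), zero_mul] at this
      refine this.congr' ?_
      filter_upwards [hev] with r hr
      have e : r ^ (1 + σ) = r ^ (1 - (N:ℝ)) * r ^ (N + σ) := by
        rw [← Real.rpow_add hr.1]
        congr 1
        ring
      have h2 := (Real.rpow_pos_of_pos hr.1 ((N:ℝ) + σ)).ne'
      rw [e]
      field_simp
    have h2 : 0 < 1 / (p - 1) := by
      have : 0 < p - 1 := by linarith
      positivity
    have := h1.rpow_const (Or.inr h2.le) (p := 1 / (p - 1))
    rwa [Real.zero_rpow h2.ne'] at this
  have hnorm0 : Tendsto (fun x : Space N => ‖x‖) (𝓝[≠] 0) (𝓝[>] 0) := tendsto_norm_nhdsNE_zero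
  have hderiv0 : HasDerivWithinAt u 0 (Ici 0) 0 := by
    refine hasDerivWithinAt_Ici_of_tendsto_deriv (s := Ioo 0 R) ?_ ?_ (Ioo_mem_nhdsGT hR) ?_
    · intro r hr
      exact (hs.u_deriv r hr).differentiableAt.differentiableWithinAt
    · have : Tendsto u (𝓝[>] 0) (𝓝 (u 0)) := by rwa [hu0]
      exact this.mono_left (nhdsWithin_mono 0 Ioo_subset_Ioi_self)
    · refine hslope.congr' ?_
      filter_upwards [hev] with r hr
      exact (hs.hasDerivAt_u hp1 hr).deriv.symm
  have hfd0 : HasFDerivAt v (0 : Space N →L[ℝ] ℝ) 0 := by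
    have h1 : Tendsto (fun x : Space N => ‖x‖) (𝓝 0) (𝓝[≥] 0) := by
      refine tendsto_nhdsWithin_iff.2 ⟨?_, Eventually.of_forall fun x => norm_nonneg x⟩
      simpa using (continuous_norm (E := Space N)).tendsto 0
    have h2 := (hasDerivWithinAt_iff_isLittleO.1 hderiv0).comp_tendsto h1
    rw [hasFDerivAt_iff_isLittleO_nhds_zero]
    refine ((h2.neg_left).congr ?_ ?_).of_norm_right
    · intro x
      simp [hv, radial]
    · intro x
      simp
  have hgrad0 : gradient v 0 = 0 := by
    unfold gradient
    rw [hfd0.fderiv, map_zero]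
  have hopen : IsOpen (Metric.ball (0 : Space N) R \ {0}) :=
    Metric.isOpen_ball.sdiff isClosed_singleton
  have hball : ∀ᶠ x in 𝓝 (0 : Space N), x ∈ Metric.ball (0 : Space N) R :=
    Metric.ball_mem_nhds 0 hR
  -- the field is `g(|x|) x` with `g` continuous at the origin
  set g₀ : ℝ := -(0 ^ σ * (α ^ (-m) / (N + σ))) with hg₀
  have hg : Tendsto (fun r => -(r ^ (-(N:ℝ)) * W r)) (𝓝[>] 0) (𝓝 g₀) := by
    refine (((hpow σ hσ).mul hlim).neg).congr' ?_
    filter_upwards [hev] with r hr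
    have e : r ^ σ = r ^ (-(N:ℝ)) * r ^ (N + σ) := by
      rw [← Real.rpow_add hr.1]
      congr 1
      ring
    have h2 := (Real.rpow_pos_of_pos hr.1 ((N:ℝ) + σ)).ne'
    rw [e]
    field_simp
  have hF0 : HasFDerivAt (pFlux p v) (g₀ • ContinuousLinearMap.id ℝ (Space N)) 0 := by
    have hzero : pFlux p v 0 = 0 := by simp [pFlux, hgrad0]
    rw [hasFDerivAt_iff_isLittleO_nhds_zero, Asymptotics.isLittleO_iff]
    intro c hc
    have h1 := (Metric.tendsto_nhds.1 (hg.comp hnorm0)) c hc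
    rw [eventually_nhdsWithin_iff] at h1
    filter_upwards [h1, hball] with x hx hxR
    rw [zero_add, hzero, sub_zero]
    by_cases h0 : x = 0
    · simp [h0, hzero]
    · rw [mem_ball_zero_iff] at hxR
      have h2 := hx h0
      simp only [Function.comp] at h2
      rw [hv, hs.pFlux_eq hp1 h0 hxR, smul_apply,
        ContinuousLinearMap.id_apply, ← sub_smul, norm_smul]
      rw [Real.dist_eq] at h2
      exact mul_le_mul_of_nonneg_right h2.le (norm_nonneg _)
  have hcases : ∀ x ∈ Metric.ball (0 : Space N) R, x = 0 ∨
      x ∈ Metric.ball (0 : Space N) R \ {0} := by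
    intro x hx
    by_cases h0 : x = 0
    · exact Or.inl h0
    · exact Or.inr ⟨hx, h0⟩
  refine ⟨?_, ?_, ?_, ?_⟩
  · have h1 := (contDiffOn_succ_iff_fderiv_of_isOpen (n := 0) hopen).1
      (by simpa using hpun.contDiffOn)
    rw [show (1 : WithTop ℕ∞) = 0 + 1 by norm_num,
      contDiffOn_succ_iff_fderiv_of_isOpen Metric.isOpen_ball, contDiffOn_zero]
    refine ⟨?_, by simp, ?_⟩
    · intro x hx
      rcases hcases x hx with rfl | hx
      · exact hfd0.differentiableAt.differentiableWithinAt
      · exact ((h1.1 x hx).differentiableAt (hopen.mem_nhds hx)).differentiableWithinAt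
    · intro x hx
      rcases hcases x hx with rfl | hx
      · refine ContinuousAt.continuousWithinAt ?_
        rw [continuousAt_iff_punctured_nhds, hfd0.fderiv, tendsto_zero_iff_norm_tendsto_zero]
        refine (hslope.comp hnorm0).congr' ?_
        have hb' : ∀ᶠ x in 𝓝[≠] (0 : Space N), x ∈ Metric.ball (0 : Space N) R :=
          hball.filter_mono nhdsWithin_le_nhds
        filter_upwards [hb', self_mem_nhdsWithin] with x hxR hx0
        rw [mem_ball_zero_iff] at hxR
        have h0 : 0 < ‖x‖ := norm_pos_iff.2 hx0
        have hW0 := hs.W_pos _ ⟨h0, hxR⟩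
        have h3 := hasGradientAt_radial hx0 ((hs.hasDerivAt_u hp1 ⟨h0, hxR⟩).const_sub 1)
        have h4 : 0 ≤ (‖x‖ ^ (1 - (N:ℝ)) * W ‖x‖) ^ (1 / (p - 1)) := by positivity
        rw [hasGradientAt_iff_hasFDerivAt] at h3
        rw [hv, h3.fderiv, LinearIsometryEquiv.norm_map, norm_smul, norm_div, norm_norm,
          div_mul_cancel₀ _ h0.ne', norm_neg, Real.norm_of_nonneg h4]
        rfl
      · exact ((contDiffOn_zero.1 h1.2.2).continuousAt (hopen.mem_nhds hx)).continuousWithinAt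
  · intro x hx
    rcases hcases x hx with rfl | hx
    · exact hF0.differentiableAt.differentiableWithinAt
    · exact ((hpun.differentiableOn_flux x hx).differentiableAt
        (hopen.mem_nhds hx)).differentiableWithinAt
  · intro x hx
    rcases hcases x hx with rfl | hx
    · simp [hv, radial, hu0, hα]
    · exact hpun.lt_one x hx
  · intro x hx
    rcases hcases x hx with rfl | hx
    · unfold pLaplacian
      rw [divergence_eq_of_hasFDerivAt_smul_id hF0, hg₀]
      simp only [hv, radial, norm_zero, hu0, sub_sub_cancel]
      rw [Real.rpow_neg hα.le]
      rcases hσ.eq_or_lt with rfl | hσ'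
      · simp
        field_simp
      · simp [Real.zero_rpow hσ'.ne']
    · exact hpun.equation x hx

end ToPDE

/-! ### Solutions give profiles -/

/-- The radial equation satisfied by the profile of a radial solution, before the sign of the
slope `u'` is known. -/
structure SignedProfile (n p m σ R : ℝ) (u u' W : ℝ → ℝ) : Prop where
  u_pos : ∀ r ∈ Ioo 0 R, 0 < u r
  u_deriv : ∀ r ∈ Ioo 0 R, HasDerivAt u (u' r) r
  W_deriv : ∀ r ∈ Ioo 0 R, HasDerivAt W (r ^ (n - 1 + σ) * u r ^ (-m)) r
  W_eq : ∀ r ∈ Ioo 0 R, W r = r ^ (n - 1) * (|u' r| ^ (p - 2) * u' r)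

theorem IsRadialSolution.exists_signedProfile {N : ℕ} {p σ m R a : ℝ} {w : ℝ → ℝ} (hN : 0 < N)
    (h : IsRadialSolution N p σ m R a w) :
    ∃ u' W, SignedProfile N p m σ R (fun r => 1 - w r) u' W := by
  obtain ⟨e, he⟩ := exists_norm_eq_one_of_pos hN
  have hs := h.solves
  have hopen : IsOpen (Metric.ball (0 : Space N) R \ {0}) :=
    Metric.isOpen_ball.sdiff isClosed_singleton
  have hnorm : ∀ r : ℝ, 0 < r → ‖r • e‖ = r := fun r hr => by
    rw [norm_smul, he, mul_one, Real.norm_of_nonneg hr.le]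
  have hmem : ∀ r ∈ Ioo 0 R, r • e ∈ Metric.ball (0 : Space N) R \ {0} := by
    intro r hr
    refine ⟨?_, ?_⟩
    · rw [mem_ball_zero_iff, hnorm r hr.1]
      exact hr.2
    · intro h0
      have h1 := hnorm r hr.1
      rw [mem_singleton_iff.1 h0, norm_zero] at h1
      exact hr.1.ne h1
  have hray : ∀ r : ℝ, HasDerivAt (fun r : ℝ => r • e) e r := fun r => by
    simpa using (hasDerivAt_id' r).smul_const e
  have hw : ∀ r ∈ Ioo 0 R, HasDerivAt w (deriv w r) r := by
    intro r hr
    have h1 : DifferentiableAt ℝ (radial N w) (r • e) :=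
      (hs.contDiffOn.differentiableOn (by norm_num) _ (hmem r hr)).differentiableAt
        (hopen.mem_nhds (hmem r hr))
    have h2 : DifferentiableAt ℝ (fun r : ℝ => radial N w (r • e)) r :=
      DifferentiableAt.comp (g := radial N w) r h1 (hray r).differentiableAt
    refine (h2.congr_of_eventuallyEq ?_).hasDerivAt
    filter_upwards [lt_mem_nhds hr.1] with q hq
    simp only [radial]
    rw [hnorm q hq]
  set φ : ℝ → ℝ := fun r => inner ℝ (pFlux p (radial N w) (r • e)) e with hφ
  have hφ' : ∀ r ∈ Ioo 0 R, HasDerivAt φ (deriv φ r) r := by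
    intro r hr
    have h1 : DifferentiableAt ℝ (pFlux p (radial N w)) (r • e) :=
      (hs.differentiableOn_flux _ (hmem r hr)).differentiableAt (hopen.mem_nhds (hmem r hr))
    have h2 : DifferentiableAt ℝ (fun r : ℝ => pFlux p (radial N w) (r • e)) r :=
      DifferentiableAt.comp (g := pFlux p (radial N w)) r h1 (hray r).differentiableAt
    exact (h2.inner ℝ (differentiableAt_const e)).hasDerivAt
  have hφeq : ∀ r ∈ Ioo 0 R, φ r = |deriv w r| ^ (p - 2) * deriv w r := by
    intro r hr
    have hr0 := hr.1.ne'
    simp only [hφ]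
    rw [pFlux_radial (w' := deriv w r) (hmem r hr).2 (by rw [hnorm r hr.1]; exact hw r hr),
      hnorm r hr.1, smul_smul, inner_smul_left, real_inner_self_eq_norm_sq, he]
    simp
    field_simp
  have hflux : ∀ x ∈ Metric.ball (0 : Space N) R \ {0},
      pFlux p (radial N w) x = (φ ‖x‖ / ‖x‖) • x := by
    rintro x ⟨hx1, hx2⟩
    rw [mem_ball_zero_iff] at hx1
    have hr : ‖x‖ ∈ Ioo 0 R := ⟨norm_pos_iff.2 hx2, hx1⟩
    rw [pFlux_radial hx2 (hw _ hr), hφeq _ hr]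
  refine ⟨fun r => -deriv w r, fun r => -(r ^ ((N:ℝ) - 1) * φ r), ?_, ?_, ?_, ?_⟩
  · intro r hr
    have := hs.lt_one _ (hmem r hr)
    simp only [radial, hnorm r hr.1] at this
    linarith
  · intro r hr
    exact (hw r hr).const_sub 1
  · intro r hr
    have h0 := hr.1
    have h1 := (((hasDerivAt_id' r).rpow_const (p := (N:ℝ) - 1) (Or.inl h0.ne')).mul
      (hφ' r hr)).neg
    refine h1.congr_deriv ?_
    have hx := hmem r hr
    have hg : HasDerivAt (fun r => φ r / r) ((deriv φ r * r - φ r * 1) / r ^ 2) ‖r • e‖ := by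
      rw [hnorm r hr.1]
      exact (hφ' r hr).div (hasDerivAt_id' r) h0.ne'
    have heq := hs.equation _ hx
    unfold pLaplacian at heq
    rw [divergence_smul_radial hx.2 hg (by
      filter_upwards [hopen.mem_nhds hx] with y hy using hflux y hy)] at heq
    simp only [radial, hnorm r hr.1] at heq
    have hu : 0 < 1 - w r := by
      have := hs.lt_one _ (hmem r hr)
      simp only [radial, hnorm r hr.1] at this
      linarith
    rw [Real.rpow_neg hu.le, Real.rpow_add h0, ← div_eq_mul_inv, mul_div_assoc, ← heq,
      Real.rpow_sub_one h0.ne' ((N:ℝ) - 1)]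
    field_simp
    ring
  · intro r hr
    rw [hφeq r hr, abs_neg]
    ring

/-! ### Behaviour of a profile at the origin -/

section Origin

variable {n p m σ R : ℝ} {u u' W : ℝ → ℝ}

lemma eq_rpow_of_eq_mul_abs_rpow (hp : 1 < p) {r q V : ℝ} (hr : 0 < r) (hV : 0 < V)
    (h : V = r ^ (n - 1) * (|q| ^ (p - 2) * q)) : q = (r ^ (1 - n) * V) ^ (1 / (p - 1)) := by
  have hq : 0 < q := by
    by_contra! hc
    have : r ^ (n - 1) * (|q| ^ (p - 2) * q) ≤ 0 :=
      mul_nonpos_of_nonneg_of_nonpos (by positivity)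
        (mul_nonpos_of_nonneg_of_nonpos (by positivity) hc)
    linarith
  have hp' : p - 1 ≠ 0 := by linarith
  have e1 : r ^ (1 - n) * r ^ (n - 1) = 1 := by
    rw [← Real.rpow_add hr]
    simp
  have e2 : q ^ (p - 2) * q = q ^ (p - 1) := by
    rw [← Real.rpow_add_one hq.ne']
    congr 1
    ring
  rw [h, abs_of_pos hq, e2, ← mul_assoc, e1, one_mul, ← Real.rpow_mul hq.le,
    mul_one_div_cancel hp', Real.rpow_one]

/-- A flux bounded away from zero makes `r |u'|` bounded away from zero near the origin, because
`(n - 1) / (p - 1) > 1`. -/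
lemma le_mul_rpow_of_le_flux (hp : 1 < p) (hn : p < n) {c V r : ℝ} (hc : 0 < c) (hcV : c ≤ V)
    (hr : r ∈ Ioo 0 R) :
    c ^ (1 / (p - 1)) * R ^ (1 + (1 - n) * (1 / (p - 1))) ≤
      r * (r ^ (1 - n) * V) ^ (1 / (p - 1)) := by
  have hp1 : 0 < p - 1 := by linarith
  have hr0 := hr.1
  have hV : 0 < V := hc.trans_le hcV
  have e : r * (r ^ (1 - n) * V) ^ (1 / (p - 1)) =
      V ^ (1 / (p - 1)) * r ^ (1 + (1 - n) * (1 / (p - 1))) := by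
    rw [Real.mul_rpow (by positivity) hV.le, ← Real.rpow_mul hr0.le, Real.rpow_add hr0,
      Real.rpow_one]
    ring
  rw [e]
  have h1 : c ^ (1 / (p - 1)) ≤ V ^ (1 / (p - 1)) :=
    Real.rpow_le_rpow hc.le hcV (by positivity)
  have h2 : 1 + (1 - n) * (1 / (p - 1)) ≤ 0 := by
    have : 1 + (1 - n) * (1 / (p - 1)) = (p - n) / (p - 1) := by
      field_simp
      ring
    rw [this]
    exact div_nonpos_of_nonpos_of_nonneg (by linarith) hp1.le
  have h3 := Real.rpow_le_rpow_of_nonpos hr0 hr.2.le h2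
  have hR : 0 < R := hr0.trans hr.2
  exact mul_le_mul h1 h3 (by positivity) (by positivity)

/-- A solution that is bounded at the origin carries no flux there, and is increasing. -/
theorem SignedProfile.flux (hp : 1 < p) (hn : p < n)
    (hs : SignedProfile n p m σ R u u' W) {α : ℝ} (hu : Tendsto u (𝓝[>] 0) (𝓝 α)) (hR : 0 < R) :
    ProfileSolution n p m σ (Ioo 0 R) u W ∧ Tendsto W (𝓝[>] 0) (𝓝 0) := by
  have hmono : StrictMonoOn W (Ioo 0 R) := by
    refine strictMonoOn_of_deriv_pos (convex_Ioo 0 R)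
      (fun r hr => (hs.W_deriv r hr).continuousAt.continuousWithinAt) (fun r hr => ?_)
    rw [interior_Ioo] at hr
    rw [(hs.W_deriv r hr).deriv]
    exact mul_pos (Real.rpow_pos_of_pos hr.1 _) (Real.rpow_pos_of_pos (hs.u_pos r hr) _)
  have hp1 : 0 < p - 1 := by linarith
  -- negative flux would force `u → ∞`
  have hWpos : ∀ r ∈ Ioo 0 R, 0 < W r := by
    intro r₁ hr₁
    by_contra! hW
    obtain ⟨b, hb, hbu⟩ : ∃ b ∈ Ioo 0 r₁, ∀ r ∈ Ioo 0 b, u r < α + 1 := by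
      have h1 : ∀ᶠ r in 𝓝[>] (0:ℝ), u r < α + 1 := hu.eventually_lt_const (by linarith)
      have h2 : ∀ᶠ r in 𝓝[>] (0:ℝ), r < r₁ := (Ioo_mem_nhdsGT hr₁.1 :
        Ioo 0 r₁ ∈ 𝓝[>] (0:ℝ)) |> fun h => by filter_upwards [h] with r hr using hr.2
      obtain ⟨b, hb, hbs⟩ := (mem_nhdsGT_iff_exists_Ioo_subset (a := (0:ℝ))).1 (h1.and h2)
      refine ⟨min b (r₁ / 2), ⟨lt_min hb (by linarith [hr₁.1]),
        (min_le_right _ _).trans_lt (by linarith [hr₁.1])⟩, fun r hr => ?_⟩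
      exact (hbs ⟨hr.1, hr.2.trans_le (min_le_left _ _)⟩).1
    have hbR : b ∈ Ioo 0 R := ⟨hb.1, hb.2.trans hr₁.2⟩
    have hWb : W b < 0 := (hmono hbR hr₁ hb.2).trans_le hW
    have hsub : ∀ r ∈ Ioo 0 b, r ∈ Ioo 0 R := fun r hr => ⟨hr.1, hr.2.trans hbR.2⟩
    obtain ⟨r, hr, hr'⟩ := exists_gt_of_mul_deriv_le_near_zero hb.1
      (δ := (-W b) ^ (1 / (p - 1)) * b ^ (1 + (1 - n) * (1 / (p - 1))))
      (mul_pos (Real.rpow_pos_of_pos (by linarith) _) (Real.rpow_pos_of_pos hb.1 _))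
      (fun r hr => hs.u_deriv r (hsub r hr)) (fun r hr => by
        have hlt := hmono (hsub r hr) hbR hr.2
        have h1 := eq_rpow_of_eq_mul_abs_rpow (n := n) (q := -u' r) (V := -W r) hp hr.1
          (by linarith) (by rw [hs.W_eq r (hsub r hr), abs_neg]; ring)
        have h2 := le_mul_rpow_of_le_flux hp hn (c := -W b) (V := -W r) (by linarith)
          (by linarith) hr
        rw [← h1] at h2
        linarith) (α + 1)
    exact absurd (hbu r hr) (not_lt.2 hr'.le)
  have hu' : ∀ r ∈ Ioo 0 R, u' r = (r ^ (1 - n) * W r) ^ (1 / (p - 1)) := fun r hr =>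
    eq_rpow_of_eq_mul_abs_rpow hp hr.1 (hWpos r hr) (hs.W_eq r hr)
  refine ⟨ProfileSolution.of_rpow hp (fun r hr => hr.1) hs.u_pos hWpos (fun r hr => ?_)
    hs.W_deriv, ?_⟩
  · rw [← hu' r hr]
    exact hs.u_deriv r hr
  -- flux bounded away from zero would force `u → -∞`
  have hex : ∀ c > 0, ∃ r ∈ Ioo 0 R, W r < c := by
    intro c hc
    by_contra! hcon
    obtain ⟨r, hr, hr'⟩ := exists_gt_of_mul_deriv_le_near_zero hR
      (δ := c ^ (1 / (p - 1)) * R ^ (1 + (1 - n) * (1 / (p - 1)))) (f := fun r => -u r)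
      (f' := fun r => -u' r)
      (mul_pos (Real.rpow_pos_of_pos hc _) (Real.rpow_pos_of_pos hR _))
      (fun r hr => (hs.u_deriv r hr).neg) (fun r hr => by
        have h2 := le_mul_rpow_of_le_flux hp hn hc (hcon r hr) hr
        rw [← hu' r hr] at h2
        linarith) 0
    linarith [hs.u_pos r hr]
  refine tendsto_order.2 ⟨fun c hc => ?_, fun c hc => ?_⟩
  · filter_upwards [Ioo_mem_nhdsGT hR] with r hr
    exact hc.trans (hWpos r hr)
  · obtain ⟨r₀, hr₀, hr₀'⟩ := hex c hc
    filter_upwards [Ioo_mem_nhdsGT hr₀.1] with r hr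
    exact (hmono ⟨hr.1, hr.2.trans hr₀.2⟩ hr₀ hr.2).trans hr₀'

/-- A profile vanishing at the origin is bounded above and below by multiples of `r ^ θ`, and its
logarithmic coordinates stay in a compact subset of the open quadrant. -/
theorem ProfileSolution.exists_bounds (h : Admissible n p m σ)
    (hs : ProfileSolution n p m σ (Ioo 0 R) u W)
    (hu : Tendsto u (𝓝[>] 0) (𝓝 0)) (hW : Tendsto W (𝓝[>] 0) (𝓝 0)) :
    ∃ c C : ℝ, 0 < c ∧ ∀ r ∈ Ioo 0 R, logSlope n p u W r ∈ Icc c C ∧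
      logFluxSlope n m σ u W r ∈ Icc c C := by
  have hp : 1 < p := by linarith [h.two_le]
  have hp1 := h.sub_one_pos
  have hm := h.m_pos
  have hnσ := h.n_add_pos
  have hθ := h.theta_pos
  have hζ := h.zeta_pos
  have hσ := h.nonneg
  set θ := theta p m σ with hθdef
  set ζ := zeta n p m σ with hζdef
  set γ := 1 / (p - 1) with hγdef
  have hγ : 0 < γ := by positivity
  have hγp : γ * (p - 1) = 1 := by
    rw [hγdef]
    field_simp
  have hζeq : ζ = n + σ - m * θ := rfl
  have hζeq' : ζ = n - p + (p - 1) * θ := h.zeta_eq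
  have hKθ : (m + p - 1) * θ = p + σ := h.exp_mul_theta
  have hpow0 : ∀ c k : ℝ, 0 < k → Tendsto (fun r : ℝ => c * r ^ k) (𝓝[>] 0) (𝓝 0) := by
    intro c k hk
    have := ((Real.continuousAt_rpow_const 0 k (Or.inr hk.le)).tendsto).const_mul c
    rw [Real.zero_rpow hk.ne', mul_zero] at this
    exact this.mono_left nhdsWithin_le_nhds
  have hpow' : ∀ c k r : ℝ, 0 < k → r ∈ Ioo 0 R →
      HasDerivAt (fun r : ℝ => c / k * r ^ k) (c * r ^ (k - 1)) r := by
    intro c k r hk hr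
    refine ((Real.hasDerivAt_rpow_const (p := k) (Or.inl hr.1.ne')).const_mul
      (c / k)).congr_deriv ?_
    field_simp
  have hmonu : MonotoneOn u (Ioo 0 R) :=
    monotoneOn_of_hasDerivAt_nonneg (convex_Ioo 0 R) isOpen_Ioo (fun r hr => hs.hasDerivAt_u hp hr)
      (fun r hr => by
        have := hs.W_pos r hr
        have := hr.1
        positivity)
  have hmonW : MonotoneOn W (Ioo 0 R) :=
    monotoneOn_of_hasDerivAt_nonneg (convex_Ioo 0 R) isOpen_Ioo (fun r hr => hs.hasDerivAt_W hr)
      (fun r hr => by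
        have := hs.u_pos r hr
        have := hr.1
        positivity)
  obtain ⟨k₁, hk₁, hW₁⟩ : ∃ k > 0, ∀ r ∈ Ioo 0 R, k * (r ^ (n + σ) * u r ^ (-m)) ≤ W r := by
    refine ⟨(1 / 2) ^ (n + σ) / (n + σ), by positivity, fun r hr => ?_⟩
    have hr0 := hr.1
    have hhalf : r / 2 ∈ Ioo 0 r := ⟨by linarith, by linarith⟩
    have hsub : ∀ q ∈ Ioo 0 r, q ∈ Ioo 0 R := fun q hq => ⟨hq.1, hq.2.trans hr.2⟩
    have h1 := le_of_hasDerivAt_le_of_tendsto_zero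
      (fun q hq => hpow' (u r ^ (-m)) (n + σ) q hnσ (hsub q hq))
      (fun q hq => hs.hasDerivAt_W (hsub q hq)) (fun q hq => by
        have e : q ^ (n + σ - 1) = q ^ (n - 1 + σ) := by congr 1; ring
        rw [e, mul_comm]
        refine mul_le_mul_of_nonneg_left ?_ (Real.rpow_nonneg hq.1.le _)
        exact Real.rpow_le_rpow_of_nonpos (hs.u_pos q (hsub q hq))
          (hmonu (hsub q hq) hr hq.2.le) (by linarith))
      (hpow0 _ _ hnσ) hW hhalf
    refine le_trans (le_of_eq ?_) (h1.trans (hmonW (hsub _ hhalf) hr hhalf.2.le))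
    rw [show r / 2 = 1 / 2 * r by ring, Real.mul_rpow (by norm_num) hr0.le]
    ring
  obtain ⟨k₃, hk₃, hu₃⟩ : ∃ k > 0, ∀ r ∈ Ioo 0 R, k * r ^ θ ≤ u r := by
    set κ := m * γ + 1 with hκ
    have hκ0 : 0 < κ := by positivity
    set β := (1 + σ) * γ with hβ
    have hβ0 : 0 < β := by positivity
    have hk₂ : 0 < κ * k₁ ^ γ / (β + 1) := by positivity
    refine ⟨(κ * k₁ ^ γ / (β + 1)) ^ (1 / κ), by positivity, fun r hr => ?_⟩
    have hr0 := hr.1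
    have h1 := le_of_hasDerivAt_le_of_tendsto_zero
      (fun q hq => hpow' (κ * k₁ ^ γ) (β + 1) q (by positivity) hq)
      (fun q hq => (hs.hasDerivAt_u hp hq).rpow_const (p := κ) (Or.inl (hs.u_pos q hq).ne'))
      (fun q hq => by
        have hq0 := hq.1
        have hu0 := hs.u_pos q hq
        have h2 : k₁ ^ γ * (q ^ β * u q ^ (-(m * γ))) ≤ (q ^ (1 - n) * W q) ^ γ := by
          have e : k₁ ^ γ * (q ^ β * u q ^ (-(m * γ))) =
              (q ^ (1 - n) * (k₁ * (q ^ (n + σ) * u q ^ (-m)))) ^ γ := by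
            have e1 : q ^ (1 - n) * (k₁ * (q ^ (n + σ) * u q ^ (-m))) =
                k₁ * (q ^ (1 + σ) * u q ^ (-m)) := by
              have : q ^ (1 + σ) = q ^ (1 - n) * q ^ (n + σ) := by
                rw [← Real.rpow_add hq0]
                congr 1
                ring
              rw [this]
              ring
            rw [e1, Real.mul_rpow hk₁.le (by positivity), Real.mul_rpow (by positivity)
              (by positivity), ← Real.rpow_mul hq0.le, ← Real.rpow_mul hu0.le, neg_mul]
          rw [e]
          exact Real.rpow_le_rpow (by positivity)
            (mul_le_mul_of_nonneg_left (hW₁ q hq) (by positivity)) hγ.le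
        have e3 : u q ^ (κ - 1) * u q ^ (-(m * γ)) = 1 := by
          rw [← Real.rpow_add hu0]
          simp [hκ]
        rw [add_sub_cancel_right]
        calc κ * k₁ ^ γ * q ^ β
            = κ * (k₁ ^ γ * (q ^ β * u q ^ (-(m * γ)))) * u q ^ (κ - 1) := by
              linear_combination (-(κ * k₁ ^ γ * q ^ β)) * e3
          _ ≤ κ * (q ^ (1 - n) * W q) ^ γ * u q ^ (κ - 1) := by gcongr
          _ = (q ^ (1 - n) * W q) ^ γ * κ * u q ^ (κ - 1) := by ring)
      (hpow0 _ _ (by positivity)) (by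
        have := hu.rpow_const (Or.inr hκ0.le) (p := κ)
        rwa [Real.zero_rpow hκ0.ne'] at this) hr
    have hu0 := hs.u_pos r hr
    have h2 := Real.rpow_le_rpow (by positivity) h1 (by positivity : 0 ≤ 1 / κ)
    rw [← Real.rpow_mul hu0.le, mul_one_div_cancel hκ0.ne', Real.rpow_one,
      Real.mul_rpow hk₂.le (by positivity), ← Real.rpow_mul hr0.le] at h2
    have e : (β + 1) * (1 / κ) = θ := by
      rw [mul_one_div, div_eq_iff hκ0.ne', hβ, hκ]
      have : γ * ((m + p - 1) * θ) = γ * (p + σ) := by rw [hKθ]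
      linear_combination (θ - 1) * hγp - this
    rwa [e] at h2
  obtain ⟨k₄, hk₄, hW₄⟩ : ∃ k > 0, ∀ r ∈ Ioo 0 R, W r ≤ k * r ^ ζ := by
    refine ⟨k₃ ^ (-m) / ζ, by positivity, fun r hr => ?_⟩
    refine le_of_hasDerivAt_le_of_tendsto_zero (fun q hq => hs.hasDerivAt_W hq)
      (fun q hq => hpow' (k₃ ^ (-m)) ζ q hζ hq) (fun q hq => ?_) hW (hpow0 _ _ hζ) hr
    have hq0 := hq.1
    have h1 := Real.rpow_le_rpow_of_nonpos (by positivity) (hu₃ q hq)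
      (by linarith : -m ≤ 0)
    rw [Real.mul_rpow hk₃.le (by positivity), ← Real.rpow_mul hq0.le] at h1
    have e : q ^ (ζ - 1) = q ^ (n - 1 + σ) * q ^ (θ * -m) := by
      rw [← Real.rpow_add hq0]
      congr 1
      rw [hζeq]
      ring
    rw [e]
    have := mul_le_mul_of_nonneg_left h1 (Real.rpow_nonneg hq0.le (n - 1 + σ))
    linarith
  obtain ⟨k₅, hk₅, hu₅⟩ : ∃ k > 0, ∀ r ∈ Ioo 0 R, u r ≤ k * r ^ θ := by
    refine ⟨k₄ ^ γ / θ, by positivity, fun r hr => ?_⟩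
    refine le_of_hasDerivAt_le_of_tendsto_zero (fun q hq => hs.hasDerivAt_u hp hq)
      (fun q hq => hpow' (k₄ ^ γ) θ q hθ hq) (fun q hq => ?_) hu (hpow0 _ _ hθ) hr
    have hq0 := hq.1
    have hW0 := hs.W_pos q hq
    have h1 : q ^ (1 - n) * W q ≤ k₄ * q ^ (1 - n + ζ) := by
      rw [Real.rpow_add hq0]
      have := mul_le_mul_of_nonneg_left (hW₄ q hq) (Real.rpow_nonneg hq0.le (1 - n))
      linarith
    have h2 := Real.rpow_le_rpow (by positivity) h1 hγ.le
    rw [Real.mul_rpow hk₄.le (by positivity), ← Real.rpow_mul hq0.le] at h2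
    have e : (1 - n + ζ) * γ = θ - 1 := by
      rw [hζeq']
      linear_combination (θ - 1) * hγp
    rwa [e] at h2
  obtain ⟨k₆, hk₆, hW₆⟩ : ∃ k > 0, ∀ r ∈ Ioo 0 R, k * r ^ ζ ≤ W r := by
    refine ⟨k₁ * k₅ ^ (-m), by positivity, fun r hr => le_trans ?_ (hW₁ r hr)⟩
    have hr0 := hr.1
    have h1 := Real.rpow_le_rpow_of_nonpos (hs.u_pos r hr) (hu₅ r hr)
      (by linarith : -m ≤ 0)
    rw [Real.mul_rpow hk₅.le (by positivity), ← Real.rpow_mul hr0.le] at h1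
    have e : r ^ ζ = r ^ (n + σ) * r ^ (θ * -m) := by
      rw [← Real.rpow_add hr0]
      congr 1
      rw [hζeq]
      ring
    rw [e]
    have := mul_le_mul_of_nonneg_left h1 (mul_nonneg hk₁.le (Real.rpow_nonneg hr0.le (n + σ)))
    linarith
  have hlogu : ∀ r ∈ Ioo 0 R, Real.log k₃ + θ * Real.log r ≤ Real.log (u r) ∧
      Real.log (u r) ≤ Real.log k₅ + θ * Real.log r := by
    intro r hr
    have hr0 := hr.1
    rw [← Real.log_rpow hr0, ← Real.log_mul hk₃.ne' (by positivity),
      ← Real.log_mul hk₅.ne' (by positivity)]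
    exact ⟨Real.log_le_log (by positivity) (hu₃ r hr),
      Real.log_le_log (hs.u_pos r hr) (hu₅ r hr)⟩
  have hlogW : ∀ r ∈ Ioo 0 R, Real.log k₆ + ζ * Real.log r ≤ Real.log (W r) ∧
      Real.log (W r) ≤ Real.log k₄ + ζ * Real.log r := by
    intro r hr
    have hr0 := hr.1
    rw [← Real.log_rpow hr0, ← Real.log_mul hk₆.ne' (by positivity),
      ← Real.log_mul hk₄.ne' (by positivity)]
    exact ⟨Real.log_le_log (by positivity) (hW₆ r hr),
      Real.log_le_log (hs.W_pos r hr) (hW₄ r hr)⟩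
  set lX := γ * Real.log k₆ - Real.log k₅
  set hX := γ * Real.log k₄ - Real.log k₃
  set lZ := -(m * Real.log k₅) - Real.log k₄
  set hZ := -(m * Real.log k₃) - Real.log k₆
  refine ⟨Real.exp (min lX lZ), Real.exp (max hX hZ), Real.exp_pos _, fun r hr => ?_⟩
  obtain ⟨h1, h2⟩ := hlogu r hr
  obtain ⟨h3, h4⟩ := hlogW r hr
  have eX : (1 - (n - 1) / (p - 1)) * Real.log r + Real.log (W r) / (p - 1) - Real.log (u r) =
      γ * (Real.log (W r) - ζ * Real.log r) - (Real.log (u r) - θ * Real.log r) := by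
    rw [hζeq', hγdef]
    field_simp
    ring
  have eZ : (n + σ) * Real.log r - m * Real.log (u r) - Real.log (W r) =
      -(m * (Real.log (u r) - θ * Real.log r)) - (Real.log (W r) - ζ * Real.log r) := by
    rw [hζeq]
    ring
  have m1 := mul_le_mul_of_nonneg_left (sub_le_sub_right h3 (ζ * Real.log r)) hγ.le
  have m2 := mul_le_mul_of_nonneg_left (sub_le_sub_right h4 (ζ * Real.log r)) hγ.le
  have m3 := mul_le_mul_of_nonneg_left (sub_le_sub_right h1 (θ * Real.log r)) hm.le
  have m4 := mul_le_mul_of_nonneg_left (sub_le_sub_right h2 (θ * Real.log r)) hm.le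
  rw [add_sub_cancel_right] at m1 m2 m3 m4
  unfold logSlope logFluxSlope
  rw [eX, eZ]
  refine ⟨⟨Real.exp_le_exp.2 ((min_le_left _ _).trans ?_),
    Real.exp_le_exp.2 (le_trans ?_ (le_max_left _ _))⟩,
    ⟨Real.exp_le_exp.2 ((min_le_right _ _).trans ?_),
    Real.exp_le_exp.2 (le_trans ?_ (le_max_right _ _))⟩⟩ <;> linarith

/-- The only profile vanishing at the origin is the homogeneous one. -/
theorem ProfileSolution.eq_homogeneous (h : Admissible n p m σ)
    (hs : ProfileSolution n p m σ (Ioo 0 R) u W)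
    (hu : Tendsto u (𝓝[>] 0) (𝓝 0)) (hW : Tendsto W (𝓝[>] 0) (𝓝 0)) {r : ℝ} (hr : r ∈ Ioo 0 R) :
    u r = amplitude n p m σ * r ^ theta p m σ := by
  obtain ⟨c, C, hc, hcC⟩ := hs.exists_bounds h hu hW
  have hp : 1 < p := by linarith [h.two_le]
  obtain ⟨h1, h2⟩ := (hs.lotkaVolterra hp).eq_equilibrium h
    (fun q hq => lyapunov_le_of_bounds h hc (hcC q hq).1 (hcC q hq).2) r hr
  rw [hs.eq_rpow_mul h hr, h1, h2, mul_comm]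
  rfl

end Origin

/-- The homogeneous function `A r ^ θ` is a profile. -/
theorem profileSolution_homogeneous {n p m σ : ℝ} (h : Admissible n p m σ) :
    ProfileSolution n p m σ (Ioi 0) (fun r => amplitude n p m σ * r ^ theta p m σ)
      (fun r => Real.exp ((p - 1) * (Real.log (amplitude n p m σ) + Real.log (theta p m σ)))
        * r ^ zeta n p m σ) := by
  have hp1 := h.sub_one_pos
  have hK := h.exp_pos
  have hA : 0 < amplitude n p m σ := amplitude_pos
  have hθ := h.theta_pos
  have hζ := h.zeta_pos
  have hlogu : ∀ r : ℝ, 0 < r → Real.log (amplitude n p m σ * r ^ theta p m σ) =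
      Real.log (amplitude n p m σ) + theta p m σ * Real.log r := fun r hr => by
    rw [Real.log_mul hA.ne' (Real.rpow_pos_of_pos hr _).ne', Real.log_rpow hr]
  have hlogW : ∀ r : ℝ, 0 < r → Real.log (Real.exp ((p - 1) * (Real.log (amplitude n p m σ)
      + Real.log (theta p m σ))) * r ^ zeta n p m σ) =
      (p - 1) * (Real.log (amplitude n p m σ) + Real.log (theta p m σ))
        + zeta n p m σ * Real.log r := fun r hr => by
    rw [Real.log_mul (Real.exp_pos _).ne' (Real.rpow_pos_of_pos hr _).ne', Real.log_rpow hr,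
      Real.log_exp]
  refine ⟨fun r hr => hr, fun r hr => mul_pos hA (Real.rpow_pos_of_pos hr _),
    fun r hr => mul_pos (Real.exp_pos _) (Real.rpow_pos_of_pos hr _), fun r hr => ?_,
    fun r hr => ?_⟩
  · have hr0 : 0 < r := hr
    refine ((Real.hasDerivAt_rpow_const (p := theta p m σ) (Or.inl hr0.ne')).const_mul
      _).congr_deriv ?_
    unfold logSlope
    rw [hlogu r hr0, hlogW r hr0]
    have e : (1 - (n - 1) / (p - 1)) * Real.log r + ((p - 1) * (Real.log (amplitude n p m σ) +
        Real.log (theta p m σ)) + zeta n p m σ * Real.log r) / (p - 1) -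
        (Real.log (amplitude n p m σ) + theta p m σ * Real.log r) = Real.log (theta p m σ) := by
      rw [h.zeta_eq]
      field_simp
      ring
    rw [e, Real.exp_log hθ, Real.rpow_sub_one hr0.ne']
    ring
  · have hr0 : 0 < r := hr
    refine ((Real.hasDerivAt_rpow_const (p := zeta n p m σ) (Or.inl hr0.ne')).const_mul
      _).congr_deriv ?_
    unfold logFluxSlope
    rw [hlogu r hr0, hlogW r hr0]
    have e : (n + σ) * Real.log r - m * (Real.log (amplitude n p m σ) + theta p m σ * Real.log r)
        - ((p - 1) * (Real.log (amplitude n p m σ) + Real.log (theta p m σ))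
          + zeta n p m σ * Real.log r) = Real.log (zeta n p m σ) := by
      have h4 : Real.log (amplitude n p m σ) * (m + p - 1) =
          -(Real.log (zeta n p m σ) + (p - 1) * Real.log (theta p m σ)) := by
        rw [amplitude, Real.log_exp]
        field_simp
      have h5 : zeta n p m σ = n + σ - m * theta p m σ := rfl
      linear_combination -h4 - Real.log r * h5
    rw [e, Real.exp_log hζ, Real.rpow_sub_one hr0.ne']
    ring

/-! ### The integral equation -/

/-- The flux `∫₀ˢ τ ^ (n - 1 + σ) / u(τ) ^ m dτ`. -/
noncomputable def fluxIntegral (n m σ : ℝ) (u : ℝ → ℝ) (s : ℝ) : ℝ :=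
  ∫ τ in (0:ℝ)..s, τ ^ (n - 1 + σ) * u τ ^ (-m)

/-- The slope determined by the flux of `u`. -/
noncomputable def fluxSlope (n p m σ : ℝ) (u : ℝ → ℝ) (s : ℝ) : ℝ :=
  (s ^ (1 - n) * fluxIntegral n m σ u s) ^ (1 / (p - 1))

/-- The operator whose fixed points are the profiles with `u 0 = α` and zero flux at the
origin. -/
noncomputable def picard (n p m σ α : ℝ) (u : ℝ → ℝ) (r : ℝ) : ℝ :=
  α + ∫ s in (0:ℝ)..r, fluxSlope n p m σ u s

lemma abs_rpow_sub_rpow_le {q lo x y : ℝ} (hq : q ≤ 1) (hlo : 0 < lo) (hx : lo ≤ x) (hy : lo ≤ y) :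
    |x ^ q - y ^ q| ≤ |q| * lo ^ (q - 1) * |x - y| := by
  have := Convex.norm_image_sub_le_of_norm_hasDerivWithin_le (f := fun x : ℝ => x ^ q)
    (f' := fun x => q * x ^ (q - 1)) (s := Ici lo) (C := |q| * lo ^ (q - 1)) (x := y) (y := x)
    (fun z hz => (Real.hasDerivAt_rpow_const
      (Or.inl (hlo.trans_le hz).ne')).hasDerivWithinAt)
    (fun z hz => by
      rw [norm_mul, Real.norm_eq_abs,
        Real.norm_of_nonneg (Real.rpow_nonneg (hlo.trans_le hz).le _)]
      exact mul_le_mul_of_nonneg_left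
        (Real.rpow_le_rpow_of_nonpos hlo hz (by linarith)) (abs_nonneg q))
    (convex_Ici lo) hy hx
  simpa [Real.norm_eq_abs] using this

lemma hasDerivAt_integral_of_continuousOn {f : ℝ → ℝ} {R r : ℝ} (hf : ContinuousOn f (Icc 0 R))
    (hr : r ∈ Ioo 0 R) : HasDerivAt (fun r => ∫ s in (0:ℝ)..r, f s) (f r) r := by
  refine intervalIntegral.integral_hasDerivAt_right ?_ ?_ ?_
  · refine ContinuousOn.intervalIntegrable_of_Icc hr.1.le (hf.mono ?_)
    exact Icc_subset_Icc_right hr.2.le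
  · exact (hf.mono Ioo_subset_Icc_self).stronglyMeasurableAtFilter isOpen_Ioo r hr
  · exact hf.continuousAt (Icc_mem_nhds hr.1 hr.2)

section Integral

variable {n p m σ α R : ℝ} {u : ℝ → ℝ}

lemma continuousOn_fluxIntegrand (h : Admissible n p m σ) (hα : 0 < α)
    (hu : ContinuousOn u (Icc 0 R)) (hαu : ∀ r ∈ Icc 0 R, α ≤ u r) :
    ContinuousOn (fun τ => τ ^ (n - 1 + σ) * u τ ^ (-m)) (Icc 0 R) := by
  have h1 : 0 ≤ n - 1 + σ := by linarith [h.two_le, h.lt_dim, h.nonneg]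
  refine ContinuousOn.mul (fun r _ => ?_) (fun r hr => ?_)
  · exact (Real.continuousAt_rpow_const r _ (Or.inr h1)).continuousWithinAt
  · exact (hu r hr).rpow_const (Or.inl (hα.trans_le (hαu r hr)).ne')

lemma integral_const_mul_rpow (h : Admissible n p m σ) (c : ℝ) (s : ℝ) :
    ∫ τ in (0:ℝ)..s, τ ^ (n - 1 + σ) * c = c / (n + σ) * s ^ (n + σ) := by
  have h1 : 0 < n - 1 + σ := by linarith [h.two_le, h.lt_dim, h.nonneg]
  have h2 := h.n_add_pos
  rw [intervalIntegral.integral_mul_const, integral_rpow (Or.inl (by linarith)),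
    show n - 1 + σ + 1 = n + σ by ring, Real.zero_rpow h2.ne']
  ring

lemma intervalIntegrable_rpow_mul (h : Admissible n p m σ) (c s : ℝ) :
    IntervalIntegrable (fun τ : ℝ => τ ^ (n - 1 + σ) * c) MeasureTheory.volume 0 s :=
  (intervalIntegral.intervalIntegrable_rpow
    (Or.inl (by linarith [h.two_le, h.lt_dim, h.nonneg]))).mul_const c

lemma fluxIntegral_le (h : Admissible n p m σ) (hα : 0 < α)
    (hu : ContinuousOn u (Icc 0 R)) (hαu : ∀ r ∈ Icc 0 R, α ≤ u r) {s : ℝ} (hs : s ∈ Icc 0 R) :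
    fluxIntegral n m σ u s ≤ α ^ (-m) / (n + σ) * s ^ (n + σ) := by
  have hsub : Icc 0 s ⊆ Icc 0 R := Icc_subset_Icc_right hs.2
  rw [← integral_const_mul_rpow h]
  refine intervalIntegral.integral_mono_on hs.1 ?_ (intervalIntegrable_rpow_mul h _ _) ?_
  · exact ((continuousOn_fluxIntegrand h hα hu hαu).mono hsub).intervalIntegrable_of_Icc hs.1
  · intro τ hτ
    refine mul_le_mul_of_nonneg_left ?_ (Real.rpow_nonneg hτ.1 _)
    exact Real.rpow_le_rpow_of_nonpos hα (hαu τ (hsub hτ)) (by linarith [h.m_pos])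

lemma le_fluxIntegral (h : Admissible n p m σ) (hα : 0 < α)
    (hu : ContinuousOn u (Icc 0 R)) (hαu : ∀ r ∈ Icc 0 R, α ≤ u r) {M : ℝ}
    (hM : ∀ r ∈ Icc 0 R, u r ≤ M) {s : ℝ} (hs : s ∈ Icc 0 R) :
    M ^ (-m) / (n + σ) * s ^ (n + σ) ≤ fluxIntegral n m σ u s := by
  have hsub : Icc 0 s ⊆ Icc 0 R := Icc_subset_Icc_right hs.2
  rw [← integral_const_mul_rpow h]
  refine intervalIntegral.integral_mono_on hs.1 (intervalIntegrable_rpow_mul h _ _) ?_ ?_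
  · exact ((continuousOn_fluxIntegrand h hα hu hαu).mono hsub).intervalIntegrable_of_Icc hs.1
  · intro τ hτ
    refine mul_le_mul_of_nonneg_left ?_ (Real.rpow_nonneg hτ.1 _)
    exact Real.rpow_le_rpow_of_nonpos (hα.trans_le (hαu τ (hsub hτ))) (hM τ (hsub hτ))
      (by linarith [h.m_pos])

lemma fluxIntegral_nonneg (hα : 0 < α) (hαu : ∀ r ∈ Icc 0 R, α ≤ u r) {s : ℝ}
    (hs : s ∈ Icc 0 R) : 0 ≤ fluxIntegral n m σ u s :=
  intervalIntegral.integral_nonneg hs.1 fun τ hτ => mul_nonneg (Real.rpow_nonneg hτ.1 _)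
    (Real.rpow_nonneg (hα.le.trans (hαu τ ⟨hτ.1, hτ.2.trans hs.2⟩)) _)

lemma fluxSlope_nonneg (hα : 0 < α) (hαu : ∀ r ∈ Icc 0 R, α ≤ u r) {s : ℝ}
    (hs : s ∈ Icc 0 R) : 0 ≤ fluxSlope n p m σ u s :=
  Real.rpow_nonneg (mul_nonneg (Real.rpow_nonneg hs.1 _) (fluxIntegral_nonneg hα hαu hs)) _

lemma fluxSlope_le (h : Admissible n p m σ) (hα : 0 < α)
    (hu : ContinuousOn u (Icc 0 R)) (hαu : ∀ r ∈ Icc 0 R, α ≤ u r) {s : ℝ} (hs : s ∈ Icc 0 R) :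
    fluxSlope n p m σ u s ≤ (α ^ (-m) / (n + σ) * s ^ (1 + σ)) ^ (1 / (p - 1)) := by
  have hp1 := h.sub_one_pos
  have hnσ := h.n_add_pos
  have hσ := h.nonneg
  have hflux := fluxIntegral_nonneg (n := n) (m := m) (σ := σ) hα hαu hs
  refine Real.rpow_le_rpow (mul_nonneg (Real.rpow_nonneg hs.1 _) hflux) ?_ (by positivity)
  rcases hs.1.eq_or_lt with h0 | h0
  · subst h0
    simp only [fluxIntegral, intervalIntegral.integral_same, mul_zero]
    positivity
  · have h1 := mul_le_mul_of_nonneg_left (fluxIntegral_le h hα hu hαu hs)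
      (Real.rpow_nonneg hs.1 (1 - n))
    refine h1.trans (le_of_eq ?_)
    have e : s ^ (1 + σ) = s ^ (1 - n) * s ^ (n + σ) := by
      rw [← Real.rpow_add h0]
      congr 1
      ring
    rw [e]
    ring

lemma continuousOn_fluxIntegral (h : Admissible n p m σ) (hα : 0 < α)
    (hu : ContinuousOn u (Icc 0 R)) (hαu : ∀ r ∈ Icc 0 R, α ≤ u r) :
    ContinuousOn (fluxIntegral n m σ u) (Icc 0 R) := by
  rcases lt_or_ge R 0 with hR | hR
  · rw [Icc_eq_empty (not_le.2 hR)]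
    exact continuousOn_empty _
  · have := intervalIntegral.continuousOn_primitive_interval (a := 0) (b := R)
      (f := fun τ => τ ^ (n - 1 + σ) * u τ ^ (-m)) (μ := MeasureTheory.volume) (by
        rw [uIcc_of_le hR]
        exact (continuousOn_fluxIntegrand h hα hu hαu).integrableOn_Icc)
    rwa [uIcc_of_le hR] at this

lemma continuousOn_fluxSlope (h : Admissible n p m σ) (hα : 0 < α)
    (hu : ContinuousOn u (Icc 0 R)) (hαu : ∀ r ∈ Icc 0 R, α ≤ u r) :
    ContinuousOn (fluxSlope n p m σ u) (Icc 0 R) := by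
  have hp1 := h.sub_one_pos
  have hγ : 0 < 1 / (p - 1) := by positivity
  intro s hs
  rcases hs.1.eq_or_lt with h0 | h0
  · subst h0
    -- near the origin the slope is squeezed by a power of `s`
    have hzero : fluxSlope n p m σ u 0 = 0 := by
      simp [fluxSlope, fluxIntegral, Real.zero_rpow (inv_pos.2 hp1).ne']
    have hup : Tendsto (fun s : ℝ => (α ^ (-m) / (n + σ) * s ^ (1 + σ)) ^ (1 / (p - 1)))
        (𝓝[Icc 0 R] 0) (𝓝 0) := by
      have h1 : (0:ℝ) < 1 + σ := by linarith [h.nonneg]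
      have h2 := (((Real.continuousAt_rpow_const 0 (1 + σ) (Or.inr h1.le)).tendsto).const_mul
        (α ^ (-m) / (n + σ))).rpow_const (p := 1 / (p - 1)) (Or.inr hγ.le)
      rw [Real.zero_rpow h1.ne', mul_zero, Real.zero_rpow hγ.ne'] at h2
      exact h2.mono_left nhdsWithin_le_nhds
    unfold ContinuousWithinAt
    rw [hzero]
    refine squeeze_zero' ?_ ?_ hup
    · filter_upwards [self_mem_nhdsWithin] with s hs using fluxSlope_nonneg hα hαu hs
    · filter_upwards [self_mem_nhdsWithin] with s hs using fluxSlope_le h hα hu hαu hs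
  · refine ContinuousWithinAt.rpow_const (ContinuousWithinAt.mul ?_
      (continuousOn_fluxIntegral h hα hu hαu s hs)) (Or.inr hγ.le)
    exact (Real.continuousAt_rpow_const s _ (Or.inl h0.ne')).continuousWithinAt

/-- A bound on `[0, R]` for the functions in the range of `picard`. -/
noncomputable def picardBound (n p m σ α R : ℝ) : ℝ :=
  α + (α ^ (-m) / (n + σ) * R ^ (1 + σ)) ^ (1 / (p - 1)) * R

lemma picard_mem_Icc (h : Admissible n p m σ) (hα : 0 < α)
    (hu : ContinuousOn u (Icc 0 R)) (hαu : ∀ r ∈ Icc 0 R, α ≤ u r) {r : ℝ} (hr : r ∈ Icc 0 R) :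
    picard n p m σ α u r ∈ Icc α (picardBound n p m σ α R) := by
  have hp1 := h.sub_one_pos
  have hnσ := h.n_add_pos
  have hσ := h.nonneg
  have hsub : Icc 0 r ⊆ Icc 0 R := Icc_subset_Icc_right hr.2
  have hR : 0 ≤ R := hr.1.trans hr.2
  have hint := ((continuousOn_fluxSlope h hα hu hαu).mono hsub).intervalIntegrable_of_Icc hr.1
    (μ := MeasureTheory.volume)
  constructor
  · have := intervalIntegral.integral_nonneg (μ := MeasureTheory.volume) hr.1
      (fun s hs => fluxSlope_nonneg (n := n) (p := p) (m := m) (σ := σ) hα hαu (hsub hs))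
    unfold picard
    linarith
  · unfold picard picardBound
    have h1 := intervalIntegral.integral_mono_on hr.1 hint
      (intervalIntegrable_const (c := (α ^ (-m) / (n + σ) * R ^ (1 + σ)) ^ (1 / (p - 1))))
      (fun s hs => (fluxSlope_le h hα hu hαu (hsub hs)).trans (by
        have hs0 := hs.1
        have hsR := (hsub hs).2
        gcongr))
    rw [intervalIntegral.integral_const, sub_zero, smul_eq_mul] at h1
    have h2 : r * (α ^ (-m) / (n + σ) * R ^ (1 + σ)) ^ (1 / (p - 1)) ≤
        (α ^ (-m) / (n + σ) * R ^ (1 + σ)) ^ (1 / (p - 1)) * R := by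
      rw [mul_comm]
      exact mul_le_mul_of_nonneg_left hr.2 (by positivity)
    linarith

lemma continuousOn_picard (h : Admissible n p m σ) (hα : 0 < α)
    (hu : ContinuousOn u (Icc 0 R)) (hαu : ∀ r ∈ Icc 0 R, α ≤ u r) :
    ContinuousOn (picard n p m σ α u) (Icc 0 R) := by
  rcases lt_or_ge R 0 with hR | hR
  · rw [Icc_eq_empty (not_le.2 hR)]
    exact continuousOn_empty _
  · have := intervalIntegral.continuousOn_primitive_interval (a := 0) (b := R)
      (f := fluxSlope n p m σ u) (μ := MeasureTheory.volume) (by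
        rw [uIcc_of_le hR]
        exact (continuousOn_fluxSlope h hα hu hαu).integrableOn_Icc)
    rw [uIcc_of_le hR] at this
    exact continuousOn_const.add this

/-- The operator `picard` is of Volterra type: on bounded sets of functions bounded below by
`α > 0` it gains a factor `L r / (k + 1)` on differences of size `r ^ k`. -/
lemma exists_picard_lipschitz (h : Admissible n p m σ) {M : ℝ} (hα : 0 < α) (hαM : α ≤ M)
    (hR : 0 ≤ R) :
    ∃ L : ℝ, 0 ≤ L ∧ ∀ c d : ℝ → ℝ, ContinuousOn c (Icc 0 R) → ContinuousOn d (Icc 0 R) →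
      (∀ r ∈ Icc 0 R, c r ∈ Icc α M) → (∀ r ∈ Icc 0 R, d r ∈ Icc α M) → ∀ (k : ℕ) (B : ℝ),
      0 ≤ B → (∀ r ∈ Icc 0 R, |c r - d r| ≤ B * r ^ k) →
      ∀ r ∈ Icc 0 R, |picard n p m σ α c r - picard n p m σ α d r| ≤
        L * B / (k + 1) * r ^ (k + 1) := by
  have hp1 := h.sub_one_pos
  have hnσ := h.n_add_pos
  have hσ := h.nonneg
  have hm := h.m_pos
  have hn1 : 0 ≤ n - 1 + σ := by linarith [h.two_le, h.lt_dim]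
  have hM : 0 < M := hα.trans_le hαM
  set γ := 1 / (p - 1) with hγdef
  have hγ : 0 < γ := by positivity
  have hγ1 : γ ≤ 1 := by
    rw [hγdef, div_le_one hp1]
    linarith [h.two_le]
  set κ := M ^ (-m) / (n + σ) with hκ
  have hκ0 : 0 < κ := by positivity
  set C := m * α ^ (-m - 1) with hC
  have hC0 : 0 ≤ C := by positivity
  refine ⟨γ * κ ^ (γ - 1) * C * R ^ ((1 + σ) * γ), by positivity,
    fun c d hc hd hcM hdM k B hB hcd r hr => ?_⟩
  have hfc := continuousOn_fluxIntegrand (m := m) h hα hc fun r hr => (hcM r hr).1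
  have hfd := continuousOn_fluxIntegrand (m := m) h hα hd fun r hr => (hdM r hr).1
  have hflux : ∀ s ∈ Icc 0 R, |fluxIntegral n m σ c s - fluxIntegral n m σ d s| ≤
      s ^ (n - 1 + σ) * (C * (B * s ^ k)) * s := by
    intro s hs
    have hsub : Icc 0 s ⊆ Icc 0 R := Icc_subset_Icc_right hs.2
    unfold fluxIntegral
    rw [← intervalIntegral.integral_sub ((hfc.mono hsub).intervalIntegrable_of_Icc hs.1)
      ((hfd.mono hsub).intervalIntegrable_of_Icc hs.1)]
    have := intervalIntegral.norm_integral_le_of_norm_le_const (a := 0) (b := s)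
      (f := fun τ => τ ^ (n - 1 + σ) * c τ ^ (-m) - τ ^ (n - 1 + σ) * d τ ^ (-m))
      (C := s ^ (n - 1 + σ) * (C * (B * s ^ k))) (fun τ hτ => by
        rw [uIoc_of_le hs.1] at hτ
        have hτ0 := hτ.1
        have hτ' : τ ∈ Icc 0 R := ⟨hτ0.le, hτ.2.trans hs.2⟩
        rw [← mul_sub, norm_mul, Real.norm_of_nonneg (Real.rpow_nonneg hτ0.le _),
          Real.norm_eq_abs]
        have h1 := abs_rpow_sub_rpow_le (q := -m) (by linarith) hα (hcM τ hτ').1 (hdM τ hτ').1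
        rw [abs_neg, abs_of_pos hm] at h1
        have h2 := hcd τ hτ'
        have h3 : τ ^ (n - 1 + σ) ≤ s ^ (n - 1 + σ) := Real.rpow_le_rpow hτ0.le hτ.2 hn1
        have h4 : |c τ ^ (-m) - d τ ^ (-m)| ≤ C * (B * s ^ k) := by
          refine h1.trans (mul_le_mul_of_nonneg_left (h2.trans ?_) hC0)
          have := pow_le_pow_left₀ hτ0.le hτ.2 k
          gcongr
        exact mul_le_mul h3 h4 (abs_nonneg _) (Real.rpow_nonneg hs.1 _))
    rwa [Real.norm_eq_abs, sub_zero, abs_of_nonneg hs.1] at this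
  have hslope : ∀ s ∈ Ioc 0 R, |fluxSlope n p m σ c s - fluxSlope n p m σ d s| ≤
      γ * κ ^ (γ - 1) * C * R ^ ((1 + σ) * γ) * B * s ^ k := by
    intro s hs
    have hs0 := hs.1
    have hs' : s ∈ Icc 0 R := ⟨hs0.le, hs.2⟩
    have e : s ^ (1 + σ) = s ^ (1 - n) * s ^ (n + σ) := by
      rw [← Real.rpow_add hs0]
      congr 1
      ring
    have hlow : ∀ f : ℝ → ℝ, ContinuousOn f (Icc 0 R) → (∀ r ∈ Icc 0 R, f r ∈ Icc α M) →
        κ * s ^ (1 + σ) ≤ s ^ (1 - n) * fluxIntegral n m σ f s := by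
      intro f hf hfM
      have := mul_le_mul_of_nonneg_left (le_fluxIntegral (m := m) h hα hf
        (fun r hr => (hfM r hr).1) (fun r hr => (hfM r hr).2) hs') (Real.rpow_nonneg hs0.le (1 - n))
      rw [e]
      linarith
    have h1 := abs_rpow_sub_rpow_le hγ1 (by positivity : 0 < κ * s ^ (1 + σ)) (hlow c hc hcM)
      (hlow d hd hdM)
    rw [← mul_sub, abs_mul, abs_of_nonneg (Real.rpow_nonneg hs0.le (1 - n)), abs_of_pos hγ] at h1
    have h2 := mul_le_mul_of_nonneg_left (hflux s hs') (Real.rpow_nonneg hs0.le (1 - n))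
    have e2 : s ^ (1 - n) * (s ^ (n - 1 + σ) * (C * (B * s ^ k)) * s) =
        s ^ (1 + σ) * (C * (B * s ^ k)) := by
      have : s ^ (n + σ) = s ^ (n - 1 + σ) * s := by
        rw [← Real.rpow_add_one hs0.ne']
        congr 1
        ring
      rw [e, this]
      ring
    rw [e2] at h2
    have e3 : (κ * s ^ (1 + σ)) ^ (γ - 1) * s ^ (1 + σ) = κ ^ (γ - 1) * s ^ ((1 + σ) * γ) := by
      rw [Real.mul_rpow hκ0.le (by positivity), ← Real.rpow_mul hs0.le, mul_assoc,
        ← Real.rpow_add hs0]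
      congr 2
      ring
    have h5 : s ^ ((1 + σ) * γ) ≤ R ^ ((1 + σ) * γ) :=
      Real.rpow_le_rpow hs0.le hs.2 (by positivity)
    calc |fluxSlope n p m σ c s - fluxSlope n p m σ d s|
        ≤ γ * (κ * s ^ (1 + σ)) ^ (γ - 1) * (s ^ (1 - n) *
            |fluxIntegral n m σ c s - fluxIntegral n m σ d s|) := h1
      _ ≤ γ * (κ * s ^ (1 + σ)) ^ (γ - 1) * (s ^ (1 + σ) * (C * (B * s ^ k))) := by gcongr
      _ = γ * ((κ * s ^ (1 + σ)) ^ (γ - 1) * s ^ (1 + σ)) * C * B * s ^ k := by ring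
      _ = γ * (κ ^ (γ - 1) * s ^ ((1 + σ) * γ)) * C * B * s ^ k := by rw [e3]
      _ ≤ γ * (κ ^ (γ - 1) * R ^ ((1 + σ) * γ)) * C * B * s ^ k := by gcongr
      _ = γ * κ ^ (γ - 1) * C * R ^ ((1 + σ) * γ) * B * s ^ k := by ring
  have hsub : Icc 0 r ⊆ Icc 0 R := Icc_subset_Icc_right hr.2
  have hic := ((continuousOn_fluxSlope h hα hc fun r hr => (hcM r hr).1).mono
    hsub).intervalIntegrable_of_Icc hr.1 (μ := MeasureTheory.volume)
  have hid := ((continuousOn_fluxSlope h hα hd fun r hr => (hdM r hr).1).mono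
    hsub).intervalIntegrable_of_Icc hr.1 (μ := MeasureTheory.volume)
  unfold picard
  rw [add_sub_add_left_eq_sub, ← intervalIntegral.integral_sub hic hid, ← Real.norm_eq_abs]
  refine (intervalIntegral.norm_integral_le_of_norm_le hr.1
    (MeasureTheory.ae_of_all _ fun s hs => hslope s ⟨hs.1, hs.2.trans hr.2⟩)
    (by fun_prop : Continuous fun s : ℝ =>
      γ * κ ^ (γ - 1) * C * R ^ ((1 + σ) * γ) * B * s ^ k).continuousOn.intervalIntegrable).trans
    (le_of_eq ?_)
  rw [intervalIntegral.integral_const_mul, integral_pow]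
  simp
  ring

/-- The integral equation has at most one solution. -/
theorem eqOn_of_picard_eq (h : Admissible n p m σ) (hα : 0 < α) {c d : ℝ → ℝ}
    (hc : ContinuousOn c (Icc 0 R)) (hd : ContinuousOn d (Icc 0 R))
    (hcα : ∀ r ∈ Icc 0 R, α ≤ c r) (hdα : ∀ r ∈ Icc 0 R, α ≤ d r)
    (hcT : ∀ r ∈ Icc 0 R, c r = picard n p m σ α c r)
    (hdT : ∀ r ∈ Icc 0 R, d r = picard n p m σ α d r) : EqOn c d (Icc 0 R) := by
  intro r hr
  have hR : 0 ≤ R := hr.1.trans hr.2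
  set M := picardBound n p m σ α R with hM
  have hcM : ∀ r ∈ Icc 0 R, c r ∈ Icc α M := fun r hr => by
    rw [hcT r hr]
    exact picard_mem_Icc h hα hc hcα hr
  have hdM : ∀ r ∈ Icc 0 R, d r ∈ Icc α M := fun r hr => by
    rw [hdT r hr]
    exact picard_mem_Icc h hα hd hdα hr
  have hαM : α ≤ M := (hcM r hr).1.trans (hcM r hr).2
  obtain ⟨L, hL, hlip⟩ := exists_picard_lipschitz h hα hαM hR
  have hB : 0 ≤ M - α := by linarith
  have hind : ∀ k : ℕ, ∀ r ∈ Icc 0 R, |c r - d r| ≤ (M - α) * L ^ k / k.factorial * r ^ k := by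
    intro k
    induction k with
    | zero =>
      intro r hr
      have h1 := hcM r hr
      have h2 := hdM r hr
      simp only [pow_zero, mul_one, Nat.factorial_zero, Nat.cast_one, div_one]
      rw [abs_le]
      constructor <;> linarith [h1.1, h1.2, h2.1, h2.2]
    | succ k ih =>
      intro r hr
      have := hlip c d hc hd hcM hdM k _ (by positivity) ih r hr
      rw [hcT r hr, hdT r hr]
      refine this.trans (le_of_eq ?_)
      rw [Nat.factorial_succ]
      push_cast
      field_simp
      ring
  have hlim : Tendsto (fun k : ℕ => (M - α) * ((L * r) ^ k / k.factorial)) atTop (𝓝 0) := by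
    have := (FloorSemiring.tendsto_pow_div_factorial_atTop (L * r)).const_mul (M - α)
    rwa [mul_zero] at this
  have hle : |c r - d r| ≤ 0 := by
    refine ge_of_tendsto hlim (Eventually.of_forall fun k => ?_)
    refine (hind k r hr).trans (le_of_eq ?_)
    rw [mul_pow]
    ring
  have := abs_nonpos_iff.1 hle
  linarith

/-- The integral equation has a solution on `[0, ∞)`: the limit of the Picard iterates. -/
theorem exists_picard_eq (h : Admissible n p m σ) (hα : 0 < α) :
    ∃ u : ℝ → ℝ, ContinuousOn u (Ici 0) ∧ (∀ r ∈ Ici (0:ℝ), α ≤ u r) ∧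
      ∀ r ∈ Ici (0:ℝ), u r = picard n p m σ α u r := by
  set U : ℕ → ℝ → ℝ := fun k => (picard n p m σ α)^[k] (fun _ => α) with hU
  have hUs : ∀ k, U (k + 1) = picard n p m σ α (U k) := fun k => Function.iterate_succ_apply' _ _ _
  set u : ℝ → ℝ := fun r => α + ∑' k, (U (k + 1) r - U k r) with hu
  have key : ∀ R : ℝ, 0 ≤ R → ContinuousOn u (Icc 0 R) ∧ (∀ r ∈ Icc 0 R, α ≤ u r) ∧
      ∀ r ∈ Icc 0 R, u r = picard n p m σ α u r := by
    intro R hR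
    set M := picardBound n p m σ α R with hM
    have hαM : α ≤ M := by
      have := picard_mem_Icc h hα (u := fun _ => α) continuousOn_const (fun _ _ => le_rfl)
        (⟨hR, le_rfl⟩ : R ∈ Icc 0 R)
      exact this.1.trans this.2
    have hUc : ∀ k, ContinuousOn (U k) (Icc 0 R) ∧ ∀ r ∈ Icc 0 R, U k r ∈ Icc α M := by
      intro k
      induction k with
      | zero => exact ⟨continuousOn_const, fun r _ => ⟨le_rfl, hαM⟩⟩
      | succ k ih =>
        rw [hUs]
        exact ⟨continuousOn_picard h hα ih.1 fun r hr => (ih.2 r hr).1,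
          fun r hr => picard_mem_Icc h hα ih.1 (fun r hr => (ih.2 r hr).1) hr⟩
    obtain ⟨L, hL, hlip⟩ := exists_picard_lipschitz h hα hαM hR
    have hB : 0 ≤ M - α := by linarith
    have hind : ∀ k : ℕ, ∀ r ∈ Icc 0 R,
        |U (k + 1) r - U k r| ≤ (M - α) * L ^ k / k.factorial * r ^ k := by
      intro k
      induction k with
      | zero =>
        intro r hr
        have h1 := (hUc 1).2 r hr
        have h2 := (hUc 0).2 r hr
        simp only [pow_zero, mul_one, Nat.factorial_zero, Nat.cast_one, div_one, zero_add]
        rw [abs_le]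
        constructor <;> linarith [h1.1, h1.2, h2.1, h2.2]
      | succ k ih =>
        intro r hr
        have := hlip (U (k + 1)) (U k) (hUc _).1 (hUc _).1 (hUc _).2 (hUc _).2 k _
          (by positivity) ih r hr
        rw [← hUs, ← hUs] at this
        refine this.trans (le_of_eq ?_)
        rw [Nat.factorial_succ]
        push_cast
        field_simp
        ring
    have hsum : Summable fun k : ℕ => (M - α) * ((L * R) ^ k / k.factorial) :=
      (Real.summable_pow_div_factorial (L * R)).mul_left _
    have hunif : TendstoUniformlyOn U u atTop (Icc 0 R) := by
      have h1 := tendstoUniformlyOn_tsum_nat (f := fun k r => U (k + 1) r - U k r)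
        (s := Icc 0 R) hsum (fun k r hr => by
          refine (hind k r hr).trans ?_
          have e : (M - α) * ((L * R) ^ k / k.factorial) =
              (M - α) * L ^ k / k.factorial * R ^ k := by
            rw [mul_pow]
            ring
          rw [e]
          exact mul_le_mul_of_nonneg_left (pow_le_pow_left₀ hr.1 hr.2 k) (by positivity))
      rw [Metric.tendstoUniformlyOn_iff] at h1 ⊢
      intro ε hε
      filter_upwards [h1 ε hε] with k hk r hr
      have h2 := hk r hr
      rw [Finset.sum_range_sub (fun k => U k r) k] at h2
      have h3 : U 0 r = α := rfl
      rw [Real.dist_eq] at h2 ⊢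
      rw [h3] at h2
      simp only [hu]
      convert! h2 using 2
      ring
    have hptw : ∀ r ∈ Icc 0 R, Tendsto (fun k => U k r) atTop (𝓝 (u r)) := fun r hr =>
      hunif.tendsto_at hr
    have hcont : ContinuousOn u (Icc 0 R) :=
      hunif.continuousOn (Eventually.of_forall fun k => (hUc k).1).frequently
    have hmem : ∀ r ∈ Icc 0 R, u r ∈ Icc α M := fun r hr =>
      isClosed_Icc.mem_of_tendsto (hptw r hr) (Eventually.of_forall fun k => (hUc k).2 r hr)
    refine ⟨hcont, fun r hr => (hmem r hr).1, fun r hr => ?_⟩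
    have h1 : Tendsto (fun k => U (k + 1) r) atTop (𝓝 (u r)) :=
      (hptw r hr).comp (tendsto_add_atTop_nat 1)
    refine tendsto_nhds_unique h1 ?_
    rw [Metric.tendsto_nhds]
    intro ε hε
    have hε' : 0 < ε / (L * R + 1) := by positivity
    filter_upwards [Metric.tendstoUniformlyOn_iff.1 hunif _ hε'] with k hk
    have h2 := hlip (U k) u (hUc k).1 hcont (hUc k).2 hmem 0 (ε / (L * R + 1)) hε'.le
      (fun q hq => by
        have := (hk q hq).le
        rw [dist_comm, Real.dist_eq] at this
        simpa using this) r hr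
    rw [hUs, Real.dist_eq]
    refine h2.trans_lt ?_
    simp only [Nat.cast_zero, zero_add, div_one, pow_one]
    have h3 : L * (ε / (L * R + 1)) * r ≤ L * (ε / (L * R + 1)) * R :=
      mul_le_mul_of_nonneg_left hr.2 (by positivity)
    refine h3.trans_lt ?_
    rw [← sub_pos]
    have : ε - L * (ε / (L * R + 1)) * R = ε / (L * R + 1) := by
      have : 0 < L * R + 1 := by positivity
      field_simp
      ring
    rw [this]
    exact hε'
  refine ⟨u, fun r hr => ?_, fun r hr => ?_, fun r hr => ?_⟩
  · have hr0 : (0:ℝ) ≤ r := hr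
    refine ((key (r + 1) (by linarith)).1 r ⟨hr0, by linarith⟩).mono_of_mem_nhdsWithin ?_
    have : Ici (0:ℝ) ∩ Iio (r + 1) ∈ 𝓝[Ici 0] r :=
      inter_mem self_mem_nhdsWithin (mem_nhdsWithin_of_mem_nhds (Iio_mem_nhds (by linarith)))
    exact mem_of_superset this fun q hq => ⟨hq.1, hq.2.le⟩
  · exact (key r hr).2.1 r ⟨hr, le_rfl⟩
  · exact (key r hr).2.2 r ⟨hr, le_rfl⟩

/-- There is an entire profile with `u 0 = α` and zero flux at the origin. -/
theorem exists_entire_profile (h : Admissible n p m σ) (hα : 0 < α) :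
    ∃ u W : ℝ → ℝ, ProfileSolution n p m σ (Ioi 0) u W ∧ ContinuousOn u (Ici 0) ∧ u 0 = α ∧
      Tendsto W (𝓝[>] 0) (𝓝 0) := by
  obtain ⟨u, hc, hαu, hT⟩ := exists_picard_eq h hα
  have hp : 1 < p := by linarith [h.two_le]
  have hsub : ∀ R : ℝ, Icc 0 R ⊆ Ici 0 := fun R r hr => hr.1
  have hc' : ∀ R, ContinuousOn u (Icc 0 R) := fun R => hc.mono (hsub R)
  have hα' : ∀ R, ∀ r ∈ Icc 0 R, α ≤ u r := fun R r hr => hαu r hr.1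
  have hW0 : fluxIntegral n m σ u 0 = 0 := by simp [fluxIntegral]
  refine ⟨u, fluxIntegral n m σ u, ?_, hc, ?_, ?_⟩
  · refine ProfileSolution.of_rpow hp (fun r hr => hr)
      (fun r hr => hα.trans_le (hαu r (mem_Ici.2 (mem_Ioi.1 hr).le))) (fun r hr => ?_)
      (fun r hr => ?_) (fun r hr => ?_)
    · have hr0 : 0 < r := hr
      have hr' : r ∈ Icc 0 r := ⟨hr0.le, le_rfl⟩
      obtain ⟨M, hM⟩ := (isCompact_Icc.image_of_continuousOn (hc' r)).bddAbove
      have hM' : ∀ q ∈ Icc 0 r, u q ≤ M := fun q hq => hM (mem_image_of_mem u hq)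
      have hM0 : 0 < M := hα.trans_le ((hα' r r hr').trans (hM' r hr'))
      refine lt_of_lt_of_le ?_ (le_fluxIntegral h hα (hc' r) (hα' r) hM' hr')
      have := h.n_add_pos
      positivity
    · have hr0 : 0 < r := hr
      have h1 := (hasDerivAt_integral_of_continuousOn
        (continuousOn_fluxSlope h hα (hc' (r + 1)) (hα' (r + 1)))
        (⟨hr0, by linarith⟩ : r ∈ Ioo 0 (r + 1))).const_add α
      refine h1.congr_of_eventuallyEq ?_
      filter_upwards [lt_mem_nhds hr0] with q hq
      exact hT q hq.le
    · have hr0 : 0 < r := hr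
      exact hasDerivAt_integral_of_continuousOn
        (continuousOn_fluxIntegrand h hα (hc' (r + 1)) (hα' (r + 1)))
        (⟨hr0, by linarith⟩ : r ∈ Ioo 0 (r + 1))
  · rw [hT 0 (mem_Ici.2 le_rfl)]
    simp [picard]
  · have h1 := (continuousOn_fluxIntegral h hα (hc' 1) (hα' 1)) 0 ⟨le_rfl, zero_le_one⟩
    unfold ContinuousWithinAt at h1
    rw [hW0] at h1
    refine h1.mono_left ?_
    rw [← nhdsWithin_Ioc_eq_nhdsGT one_pos]
    exact nhdsWithin_mono 0 Ioc_subset_Icc_self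

/-- A profile with `u 0 = α > 0` and zero flux at the origin solves the integral equation. -/
theorem ProfileSolution.eq_picard (h : Admissible n p m σ) {W : ℝ → ℝ} (hα : 0 < α)
    (hs : ProfileSolution n p m σ (Ioo 0 R) u W) (hc : ContinuousOn u (Ico 0 R)) (hu0 : u 0 = α)
    (hW : Tendsto W (𝓝[>] 0) (𝓝 0)) {r : ℝ} (hr : r ∈ Ico 0 R) :
    α ≤ u r ∧ u r = picard n p m σ α u r := by
  have hp : 1 < p := by linarith [h.two_le]
  have hslope : ∀ r ∈ Ioo 0 R, 0 ≤ (r ^ (1 - n) * W r) ^ (1 / (p - 1)) := fun r hr => by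
    have := hs.W_pos r hr
    have := hr.1
    positivity
  have hαu : ∀ r ∈ Ico 0 R, α ≤ u r := by
    intro r hr
    have hmono : MonotoneOn u (Ico 0 R) := by
      refine monotoneOn_of_hasDerivWithinAt_nonneg
        (f' := fun r => (r ^ (1 - n) * W r) ^ (1 / (p - 1))) (convex_Ico 0 R) hc ?_ ?_
      · intro r hr
        rw [interior_Ico] at hr
        exact (hs.hasDerivAt_u hp hr).hasDerivWithinAt
      · intro r hr
        rw [interior_Ico] at hr
        exact hslope r hr
    rw [← hu0]
    exact hmono ⟨le_rfl, hr.1.trans_lt hr.2⟩ hr hr.1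
  have hWeq : ∀ r ∈ Ioo 0 R, W r = fluxIntegral n m σ u r := by
    intro r hr
    have hsub : Icc 0 r ⊆ Ico 0 R := fun q hq => ⟨hq.1, hq.2.trans_lt hr.2⟩
    have h1 := intervalIntegral.integral_eq_sub_of_hasDerivAt_of_le (a := 0) (b := r)
      (f := Function.update W 0 0) (f' := fun r => r ^ (n - 1 + σ) * u r ^ (-m)) hr.1.le
      (fun q hq => by
        rcases hq.1.eq_or_lt with h0 | h0
        · subst h0
          refine ContinuousWithinAt.mono (t := Ici 0) ?_ fun q hq => hq.1
          rw [← continuousWithinAt_Ioi_iff_Ici]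
          unfold ContinuousWithinAt
          rw [Function.update_self]
          refine hW.congr' ?_
          filter_upwards [self_mem_nhdsWithin] with q hq
          rw [Function.update_of_ne (mem_Ioi.1 hq).ne']
        · refine ContinuousAt.continuousWithinAt ?_
          rw [continuousAt_update_of_ne h0.ne']
          exact (hs.hasDerivAt_W ⟨h0, (hsub hq).2⟩).continuousAt)
      (fun q hq => by
        refine (hs.hasDerivAt_W ⟨hq.1, hq.2.trans hr.2⟩).congr_of_eventuallyEq ?_
        filter_upwards [lt_mem_nhds hq.1] with y hy
        rw [Function.update_of_ne hy.ne'])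
      ((continuousOn_fluxIntegrand h hα (hc.mono hsub)
        fun q hq => hαu q (hsub hq)).intervalIntegrable_of_Icc hr.1.le)
    rw [Function.update_self, Function.update_of_ne hr.1.ne', sub_zero] at h1
    exact h1.symm
  refine ⟨hαu r hr, ?_⟩
  have hsub : Icc 0 r ⊆ Ico 0 R := fun q hq => ⟨hq.1, hq.2.trans_lt hr.2⟩
  have h1 := intervalIntegral.integral_eq_sub_of_hasDerivAt_of_le (a := 0) (b := r)
    (f := u) (f' := fluxSlope n p m σ u) hr.1 (hc.mono hsub)
    (fun q hq => by
      have hq' : q ∈ Ioo 0 R := ⟨hq.1, hq.2.trans hr.2⟩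
      unfold fluxSlope
      rw [← hWeq q hq']
      exact hs.hasDerivAt_u hp hq')
    ((continuousOn_fluxSlope h hα (hc.mono hsub)
      fun q hq => hαu q (hsub hq)).intervalIntegrable_of_Icc hr.1)
  unfold picard
  rw [h1, hu0]
  ring

end Integral

/-! ### The critical exponent -/

/-- The condition on the critical exponent says that the linearisation at the equilibrium has
non-real eigenvalues. -/
lemma oscillation_condition {N : ℕ} {p m σ : ℝ} (h : Admissible N p m σ)
    (hqc : qcDenom N p σ ≤ 0 ∨ m / (m - p + 1) < qc N p σ) :
    (theta p m σ + zeta N p m σ) ^ 2 <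
      4 * (theta p m σ * zeta N p m σ * (m + p - 1) / (p - 1)) := by
  have hp1 := h.sub_one_pos
  have hp2 := h.two_le
  have hK := h.exp_pos
  have hM : 0 < (N:ℝ) - p := by linarith [h.lt_dim]
  have hm' : 0 < m - p + 1 := by linarith [h.lt_exp]
  have hP : 0 < p + σ := by linarith [h.nonneg]
  set Q := σ * (p - 1) + p * (N - 1) with hQ
  have hQeq : Q = (p - 1) * (p + σ) + p * (N - p) := by rw [hQ]; ring
  have hQ0 : 0 < Q := by rw [hQeq]; positivity
  set τ := √((p - 1) * Q) * √(p + σ) with hτ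
  have hs1 : √((p - 1) * Q) ^ 2 = (p - 1) * Q := Real.sq_sqrt (by positivity)
  have hs2 : √(p + σ) ^ 2 = p + σ := Real.sq_sqrt hP.le
  have hτ2 : τ ^ 2 = (p - 1) * Q * (p + σ) := by rw [hτ, mul_pow, hs1, hs2]
  have hτ0 : 0 ≤ τ := by positivity
  have hτP : (p - 1) * (p + σ) ≤ τ := by
    refine le_of_sq_le_sq ?_ hτ0
    rw [hτ2, hQeq]
    have : 0 ≤ (p - 1) * (p + σ) * (p * (N - p)) := by positivity
    linarith
  have hD : qcDenom N p σ = 4 * ((p - 1) * Q + (p + σ) - 2 * τ) - 2 * p ^ 2 * (p + σ) := by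
    unfold qcDenom
    rw [sub_sq, hs1, hs2, hτ]
    ring
  have hmain : (m + p - 1) * qcDenom N p σ < 2 * p ^ 2 * (p + σ) * (m - p + 1) := by
    have hpos : 0 < 2 * p ^ 2 * (p + σ) * (m - p + 1) := by positivity
    rcases le_or_gt (qcDenom N p σ) 0 with hD0 | hD0
    · exact (mul_nonpos_of_nonneg_of_nonpos hK.le hD0).trans_lt hpos
    · have h1 := hqc.resolve_left (not_le.2 hD0)
      unfold qc at h1
      have e1 : m / (m - p + 1) - 1 / 2 = (m + p - 1) / (2 * (m - p + 1)) := by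
        field_simp
        ring
      have h2 : (m + p - 1) / (2 * (m - p + 1)) < p ^ 2 * (p + σ) / qcDenom N p σ := by
        rw [← e1]
        linarith
      rw [div_lt_div_iff₀ (by positivity) hD0] at h2
      linarith
  set Y := (m + p - 1) * (p * (N - p) - 2 * (p + σ)) + p ^ 2 * (p + σ) with hY
  have hY1 : (p - 1) * Y < 2 * (m + p - 1) * τ := by
    rw [hD, hQeq] at hmain
    rw [hY]
    linarith
  have hY2 : -(2 * (m + p - 1) * τ) < (p - 1) * Y := by
    have h1 : (p - 1) * (2 * (p + σ)) * (m + p - 1) ≤ 2 * τ * (m + p - 1) := by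
      refine mul_le_mul_of_nonneg_right ?_ hK.le
      linarith
    have h2 : 0 < (p - 1) * (m + p - 1) * (p * (N - p)) := by positivity
    have h3 : 0 < (p - 1) * (p ^ 2 * (p + σ)) := by positivity
    rw [hY]
    linarith
  have hsq := sq_lt_sq' hY2 hY1
  have e1 : (2 * (m + p - 1) * τ) ^ 2 =
      4 * (m + p - 1) ^ 2 * ((p - 1) * ((p - 1) * (p + σ) + p * (N - p)) * (p + σ)) := by
    rw [mul_pow, hτ2, hQeq]
    ring
  rw [e1] at hsq
  have hgoal : (p * (p + σ) + (N - p) * (m + p - 1)) ^ 2 * (p - 1) <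
      4 * (p + σ) * (m + p - 1) * ((N - p) * (m + p - 1) + (p - 1) * (p + σ)) := by
    have h1 : p ^ 2 * (p - 1) * ((p * (p + σ) + (N - p) * (m + p - 1)) ^ 2 * (p - 1)) <
        p ^ 2 * (p - 1) * (4 * (p + σ) * (m + p - 1) *
          ((N - p) * (m + p - 1) + (p - 1) * (p + σ))) := by
      rw [hY] at hsq
      linear_combination hsq
    exact lt_of_mul_lt_mul_left h1 (by positivity)
  rw [h.zeta_eq]
  unfold theta
  have e2 : ((p + σ) / (m + p - 1) + (N - p + (p - 1) * ((p + σ) / (m + p - 1)))) ^ 2 =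
      (p * (p + σ) + (N - p) * (m + p - 1)) ^ 2 * (p - 1) / ((m + p - 1) ^ 2 * (p - 1)) := by
    field_simp
    ring
  have e3 : 4 * ((p + σ) / (m + p - 1) * (N - p + (p - 1) * ((p + σ) / (m + p - 1))) *
      (m + p - 1) / (p - 1)) = 4 * (p + σ) * (m + p - 1) *
        ((N - p) * (m + p - 1) + (p - 1) * (p + σ)) / ((m + p - 1) ^ 2 * (p - 1)) := by
    field_simp
  rw [e2, e3]
  exact div_lt_div_of_pos_right hgoal (by positivity)

lemma vStar_eq {N : ℕ} {p m σ : ℝ} (h : Admissible N p m σ) :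
    vStar N p σ m = fun r => 1 - amplitude N p m σ * r ^ theta p m σ := by
  have hK := h.exp_pos
  have hθ := h.theta_pos
  have hζ := h.zeta_pos
  have e1 : (m + p - 1) / ((N + σ) * (p - 1) + (N - p) * m) = (zeta N p m σ)⁻¹ := by
    have : zeta N p m σ = ((N + σ) * (p - 1) + (N - p) * m) / (m + p - 1) := by
      unfold zeta theta
      field_simp
      ring
    rw [this, inv_div]
  have e2 : (m + p - 1) / (p + σ) = (theta p m σ)⁻¹ := by
    unfold theta
    rw [inv_div]
  funext r
  unfold vStar
  rw [e1, e2]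
  congr 2
  rw [Real.rpow_def_of_pos (by positivity),
    Real.log_mul (by positivity) (by positivity), Real.log_rpow (by positivity), Real.log_inv,
    Real.log_inv]
  unfold amplitude
  congr 1
  field_simp
  ring

/-! ### Scaling -/

section Scaling

variable {n p m σ : ℝ} {u W : ℝ → ℝ}

/-- The equation is invariant under `u ↦ μ ^ θ u(· / μ)`. -/
lemma ProfileSolution.scale (h : Admissible n p m σ) (hs : ProfileSolution n p m σ (Ioi 0) u W)
    {μ : ℝ} (hμ : 0 < μ) :
    ProfileSolution n p m σ (Ioi 0) (fun r => μ ^ theta p m σ * u (r / μ))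
      (fun r => μ ^ zeta n p m σ * W (r / μ)) := by
  have hp1 := h.sub_one_pos
  have hmem : ∀ r ∈ Ioi (0:ℝ), r / μ ∈ Ioi (0:ℝ) := fun r hr => div_pos hr hμ
  have hlogu : ∀ r ∈ Ioi (0:ℝ), Real.log (μ ^ theta p m σ * u (r / μ)) =
      theta p m σ * Real.log μ + Real.log (u (r / μ)) := fun r hr => by
    rw [Real.log_mul (by positivity) (hs.u_pos _ (hmem r hr)).ne', Real.log_rpow hμ]
  have hlogW : ∀ r ∈ Ioi (0:ℝ), Real.log (μ ^ zeta n p m σ * W (r / μ)) =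
      zeta n p m σ * Real.log μ + Real.log (W (r / μ)) := fun r hr => by
    rw [Real.log_mul (by positivity) (hs.W_pos _ (hmem r hr)).ne', Real.log_rpow hμ]
  have hdiv : ∀ r : ℝ, HasDerivAt (fun r => r / μ) (1 / μ) r := fun r =>
    (hasDerivAt_id' r).div_const μ
  refine ⟨fun r hr => hr, fun r hr => mul_pos (by positivity) (hs.u_pos _ (hmem r hr)),
    fun r hr => mul_pos (by positivity) (hs.W_pos _ (hmem r hr)), fun r hr => ?_, fun r hr => ?_⟩
  · have hr0 : 0 < r := hr
    refine (((hs.u_deriv _ (hmem r hr)).comp r (hdiv r)).const_mul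
      (μ ^ theta p m σ)).congr_deriv ?_
    have e : logSlope n p (fun r => μ ^ theta p m σ * u (r / μ))
        (fun r => μ ^ zeta n p m σ * W (r / μ)) r = logSlope n p u W (r / μ) := by
      unfold logSlope
      congr 1
      rw [hlogu r hr, hlogW r hr, Real.log_div hr0.ne' hμ.ne', h.zeta_eq]
      field_simp
      ring
    rw [e]
    field_simp
  · have hr0 : 0 < r := hr
    refine (((hs.W_deriv _ (hmem r hr)).comp r (hdiv r)).const_mul
      (μ ^ zeta n p m σ)).congr_deriv ?_
    have e : logFluxSlope n m σ (fun r => μ ^ theta p m σ * u (r / μ))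
        (fun r => μ ^ zeta n p m σ * W (r / μ)) r = logFluxSlope n m σ u W (r / μ) := by
      unfold logFluxSlope
      congr 1
      rw [hlogu r hr, hlogW r hr, Real.log_div hr0.ne' hμ.ne', zeta]
      ring
    rw [e]
    field_simp

lemma tendsto_div_nhdsGT_atTop {c : ℝ} (hc : 0 < c) :
    Tendsto (fun μ : ℝ => c / μ) (𝓝[>] 0) atTop := by
  simp only [div_eq_mul_inv]
  exact tendsto_inv_nhdsGT_zero.const_mul_atTop hc

/-- A function asymptotic to a power converges to it under the corresponding scaling, locally
uniformly away from the origin. -/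
lemma tendstoUniformlyOn_scale {f : ℝ → ℝ} {κ c : ℝ}
    (hf : Tendsto (fun r => f r / r ^ κ) atTop (𝓝 c)) {K : Set ℝ} (hK : IsCompact K)
    (hK0 : K ⊆ Ioi 0) :
    TendstoUniformlyOn (fun μ r => μ ^ κ * f (r / μ)) (fun r => c * r ^ κ) (𝓝[>] 0) K := by
  rcases K.eq_empty_or_nonempty with rfl | hne
  · exact tendstoUniformlyOn_empty
  obtain ⟨ε, hεK, hε⟩ := hK.exists_isLeast hne
  have hε0 : 0 < ε := hK0 hεK
  have hcont : ContinuousOn (fun r : ℝ => r ^ κ) K := fun r hr =>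
    (Real.continuousAt_rpow_const r κ (Or.inl (mem_Ioi.1 (hK0 hr)).ne')).continuousWithinAt
  obtain ⟨B, hB⟩ := (hK.image_of_continuousOn hcont).bddAbove
  have hB' : ∀ r ∈ K, r ^ κ ≤ B := fun r hr => hB (mem_image_of_mem _ hr)
  have hB0 : 0 < B := (Real.rpow_pos_of_pos hε0 κ).trans_le (hB' ε hεK)
  rw [Metric.tendstoUniformlyOn_iff]
  intro η hη
  obtain ⟨S, hS⟩ := eventually_atTop.1 (Metric.tendsto_nhds.1 hf (η / B) (by positivity))
  filter_upwards [self_mem_nhdsWithin, (tendsto_div_nhdsGT_atTop hε0).eventually_ge_atTop S]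
    with μ hμ hμS r hr
  have hμ0 : 0 < μ := hμ
  have hr0 : 0 < r := hK0 hr
  have h1 := hS (r / μ) (hμS.trans (div_le_div_of_nonneg_right (hε hr) hμ0.le))
  rw [Real.dist_eq] at h1
  have e : c * r ^ κ - μ ^ κ * f (r / μ) = -(r ^ κ * (f (r / μ) / (r / μ) ^ κ - c)) := by
    rw [Real.div_rpow hr0.le hμ0.le]
    have h2 := (Real.rpow_pos_of_pos hr0 κ).ne'
    have h3 := (Real.rpow_pos_of_pos hμ0 κ).ne'
    field_simp
    ring
  rw [Real.dist_eq, e, abs_neg, abs_mul, abs_of_pos (Real.rpow_pos_of_pos hr0 κ)]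
  calc r ^ κ * |f (r / μ) / (r / μ) ^ κ - c| ≤ B * |f (r / μ) / (r / μ) ^ κ - c| :=
        mul_le_mul_of_nonneg_right (hB' r hr) (abs_nonneg _)
    _ < B * (η / B) := mul_lt_mul_of_pos_left h1 hB0
    _ = η := by field_simp

/-- For a positive power and a function continuous at the origin, the convergence is uniform up
to the origin. -/
lemma tendstoUniformlyOn_scale_Icc {f : ℝ → ℝ} {κ c : ℝ} (hκ : 0 < κ)
    (hf : Tendsto (fun r => f r / r ^ κ) atTop (𝓝 c)) (hfc : ContinuousOn f (Ici 0)) (R : ℝ) :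
    TendstoUniformlyOn (fun μ r => μ ^ κ * f (r / μ)) (fun r => c * r ^ κ) (𝓝[>] 0)
      (Icc 0 R) := by
  rcases lt_or_ge R 0 with hR | hR
  · rw [Icc_eq_empty (not_le.2 hR)]
    exact tendstoUniformlyOn_empty
  rw [Metric.tendstoUniformlyOn_iff]
  intro η hη
  have hB0 : 0 < R ^ κ + 1 := by positivity
  obtain ⟨S', hS'⟩ := eventually_atTop.1
    (Metric.tendsto_nhds.1 hf (η / (R ^ κ + 1)) (by positivity))
  set S := max S' 1 with hS
  have hS0 : 0 < S := one_pos.trans_le (le_max_right _ _)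
  have hcont : ContinuousOn (fun r : ℝ => |c * r ^ κ - f r|) (Icc 0 S) := by
    refine ((continuousOn_const.mul fun r _ => ?_).sub (hfc.mono fun r hr => hr.1)).abs
    exact (Real.continuousAt_rpow_const r κ (Or.inr hκ.le)).continuousWithinAt
  obtain ⟨C, hC⟩ := (isCompact_Icc.image_of_continuousOn hcont).bddAbove
  have hC' : ∀ r ∈ Icc 0 S, |c * r ^ κ - f r| ≤ C := fun r hr => hC (mem_image_of_mem _ hr)
  have hsmall : Tendsto (fun μ : ℝ => μ ^ κ * C) (𝓝[>] 0) (𝓝 0) := by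
    have := ((Real.continuousAt_rpow_const 0 κ (Or.inr hκ.le)).tendsto).mul_const C
    rw [Real.zero_rpow hκ.ne', zero_mul] at this
    exact this.mono_left nhdsWithin_le_nhds
  filter_upwards [self_mem_nhdsWithin, hsmall.eventually_lt_const hη] with μ hμ hμC r hr
  have hμ0 : 0 < μ := hμ
  have hμκ := Real.rpow_pos_of_pos hμ0 κ
  have e : c * r ^ κ - μ ^ κ * f (r / μ) = μ ^ κ * (c * (r / μ) ^ κ - f (r / μ)) := by
    rw [Real.div_rpow hr.1 hμ0.le]
    field_simp
  rw [Real.dist_eq, e, abs_mul, abs_of_pos hμκ]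
  rcases le_or_gt (r / μ) S with hle | hlt
  · exact (mul_le_mul_of_nonneg_left (hC' _ ⟨div_nonneg hr.1 hμ0.le, hle⟩) hμκ.le).trans_lt hμC
  · have hq : 0 < r / μ := hS0.trans hlt
    have h1 := hS' (r / μ) ((le_max_left _ _).trans hlt.le)
    rw [Real.dist_eq] at h1
    have hqκ := Real.rpow_pos_of_pos hq κ
    have e2 : c * (r / μ) ^ κ - f (r / μ) =
        -((r / μ) ^ κ * (f (r / μ) / (r / μ) ^ κ - c)) := by
      field_simp
      ring
    rw [e2, abs_neg, abs_mul, abs_of_pos hqκ, ← mul_assoc, ← Real.mul_rpow hμ0.le hq.le,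
      mul_div_cancel₀ _ hμ0.ne']
    have h2 : r ^ κ ≤ R ^ κ := Real.rpow_le_rpow hr.1 hr.2 hκ.le
    calc r ^ κ * |f (r / μ) / (r / μ) ^ κ - c|
        ≤ R ^ κ * |f (r / μ) / (r / μ) ^ κ - c| := by gcongr
      _ ≤ R ^ κ * (η / (R ^ κ + 1)) := by gcongr
      _ < η := by
        rw [← mul_div_assoc, div_lt_iff₀ hB0]
        linarith

end Scaling

/-! ### Radial solutions and profiles -/

section Solutions

variable {N : ℕ} {p m σ R : ℝ}

lemma ProfileSolution.isRadialSolution (hp : 1 < p) {u W : ℝ → ℝ} {a : ℝ}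
    (hs : ProfileSolution N p m σ (Ioo 0 R) u W) (hc : ContinuousOn u (Ico 0 R))
    (hu0 : u 0 = 1 - a) : IsRadialSolution N p σ m R a fun r => 1 - u r where
  continuousOn := continuousOn_const.sub hc
  value_zero := by rw [hu0]; ring
  solves := hs.solves_punctured hp

/-- The profile `1 - w` of a radial solution `w` is increasing and starts with zero flux. -/
lemma IsRadialSolution.exists_profile (h : Admissible N p m σ) (hR : 0 < R) {a : ℝ} {w : ℝ → ℝ}
    (hw : IsRadialSolution N p σ m R a w) :
    ∃ W, ProfileSolution N p m σ (Ioo 0 R) (fun r => 1 - w r) W ∧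
      Tendsto (fun r => 1 - w r) (𝓝[>] 0) (𝓝 (1 - a)) ∧ Tendsto W (𝓝[>] 0) (𝓝 0) := by
  have hN : 0 < N := by
    have : (0:ℝ) < N := by linarith [h.two_le, h.lt_dim]
    exact_mod_cast this
  obtain ⟨u', W, hs⟩ := hw.exists_signedProfile hN
  have hlim : Tendsto (fun r => 1 - w r) (𝓝[>] 0) (𝓝 (1 - a)) := by
    have h1 := hw.continuousOn 0 ⟨le_rfl, hR⟩
    unfold ContinuousWithinAt at h1
    rw [hw.value_zero] at h1
    refine (h1.mono_left ?_).const_sub 1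
    rw [← nhdsWithin_Ioo_eq_nhdsGT hR]
    exact nhdsWithin_mono 0 Ioo_subset_Ico_self
  obtain ⟨h1, h2⟩ := hs.flux (by linarith [h.two_le]) h.lt_dim hlim hR
  exact ⟨W, h1, hlim, h2⟩

theorem IsRadialSolution.eqOn_of_lt_one (h : Admissible N p m σ) {a : ℝ} (ha : a < 1)
    {w₁ w₂ : ℝ → ℝ} (hw₁ : IsRadialSolution N p σ m R a w₁)
    (hw₂ : IsRadialSolution N p σ m R a w₂) : EqOn w₁ w₂ (Ico 0 R) := by
  intro r hr
  have hR : 0 < R := hr.1.trans_lt hr.2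
  have hα : 0 < 1 - a := by linarith
  have key : ∀ w, IsRadialSolution N p σ m R a w → ∀ q ∈ Ico 0 R,
      1 - a ≤ 1 - w q ∧ 1 - w q = picard N p m σ (1 - a) (fun r => 1 - w r) q := by
    intro w hw q hq
    obtain ⟨W, hs, -, hW⟩ := hw.exists_profile h hR
    exact hs.eq_picard h hα (continuousOn_const.sub hw.continuousOn)
      (by rw [hw.value_zero]) hW hq
  have hsub : ∀ q ∈ Icc 0 r, q ∈ Ico 0 R := fun q hq => ⟨hq.1, hq.2.trans_lt hr.2⟩
  have := eqOn_of_picard_eq h hα (R := r)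
    ((continuousOn_const.sub hw₁.continuousOn).mono hsub)
    ((continuousOn_const.sub hw₂.continuousOn).mono hsub)
    (fun q hq => (key w₁ hw₁ q (hsub q hq)).1) (fun q hq => (key w₂ hw₂ q (hsub q hq)).1)
    (fun q hq => (key w₁ hw₁ q (hsub q hq)).2) (fun q hq => (key w₂ hw₂ q (hsub q hq)).2)
    (⟨hr.1, le_rfl⟩ : r ∈ Icc 0 r)
  simpa using this

theorem IsRadialSolution.eqOn_vStar (h : Admissible N p m σ) {w : ℝ → ℝ}
    (hw : IsRadialSolution N p σ m R 1 w) : EqOn w (vStar N p σ m) (Ico 0 R) := by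
  intro r hr
  have hR : 0 < R := hr.1.trans_lt hr.2
  obtain ⟨W, hs, hu, hW⟩ := hw.exists_profile h hR
  rw [sub_self] at hu
  rw [vStar_eq h]
  rcases hr.1.eq_or_lt with h0 | h0
  · subst h0
    simp only
    rw [hw.value_zero, Real.zero_rpow h.theta_pos.ne']
    simp
  · have := hs.eq_homogeneous h hu hW ⟨h0, hr.2⟩
    simp only at this ⊢
    linarith

theorem isRadialSolution_vStar (h : Admissible N p m σ) :
    IsRadialSolution N p σ m R 1 (vStar N p σ m) := by
  rw [vStar_eq h]
  refine ProfileSolution.isRadialSolution (by linarith [h.two_le])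
    ((profileSolution_homogeneous h).mono Ioo_subset_Ioi_self) ?_ ?_
  · exact continuousOn_const.mul fun r _ =>
      (Real.continuousAt_rpow_const r _ (Or.inr h.theta_pos.le)).continuousWithinAt
  · simp [Real.zero_rpow h.theta_pos.ne']

end Solutions

/-- If `Z` is unbounded, the number of points of the dilate `μ Z` in `(0, ρ)` tends to infinity as
`μ → 0+`. -/
lemma tendsto_encard_dilate {Z : Set ℝ} (hZ0 : ∀ s ∈ Z, 0 < s) (hZ : ∀ S : ℝ, ∃ s ∈ Z, S < s)
    {ρ : ℝ} (hρ : 0 < ρ) :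
    Tendsto (fun μ : ℝ => {r ∈ Ioo 0 ρ | r / μ ∈ Z}.encard) (𝓝[>] 0) (𝓝 ⊤) := by
  have hinf : Z.Infinite := by
    refine Set.infinite_of_not_bddAbove ?_
    rintro ⟨B, hB⟩
    obtain ⟨s, hs, hBs⟩ := hZ B
    exact absurd (hB hs) (not_le.2 hBs)
  rw [ENat.tendsto_nhds_top_iff_natCast_lt]
  intro k
  obtain ⟨t, htZ, htk⟩ := hinf.exists_subset_card_eq (k + 1)
  obtain ⟨B, hB⟩ := t.bddAbove
  filter_upwards [self_mem_nhdsWithin, (tendsto_div_nhdsGT_atTop hρ).eventually_gt_atTop B]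
    with μ hμ hμB
  have hμ0 : 0 < μ := hμ
  have hinj : Function.Injective fun s : ℝ => μ * s := mul_right_injective₀ hμ0.ne'
  have hsub : (fun s : ℝ => μ * s) '' (t : Set ℝ) ⊆ {r ∈ Ioo 0 ρ | r / μ ∈ Z} := by
    rintro _ ⟨s, hs, rfl⟩
    refine ⟨⟨mul_pos hμ0 (hZ0 s (htZ hs)), ?_⟩, ?_⟩
    · have h1 := (hB hs).trans_lt hμB
      rw [lt_div_iff₀ hμ0] at h1
      linarith
    · simp only
      rw [mul_div_cancel_left₀ _ hμ0.ne']
      exact htZ hs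
  have h1 := Set.encard_le_encard hsub
  rw [hinj.encard_image, Set.encard_coe_eq_coe_finsetCard, htk] at h1
  refine lt_of_lt_of_le ?_ h1
  exact_mod_cast Nat.lt_succ_self k

end MEMS

theorem proposition2p2 (N : ℕ) (p m σ : ℝ) (hp : 2 ≤ p) (hN : p < N) (hm : p - 1 < m)
    (hσ : 0 ≤ σ) :
    ∃ r₀ : ℝ, 0 < r₀ ∧
      -- the explicit function is the unique radial solution with value `1` at the origin
      MEMS.IsRadialSolution N p σ m r₀ 1 (MEMS.vStar N p σ m) ∧
      (∀ w : ℝ → ℝ, MEMS.IsRadialSolution N p σ m r₀ 1 w →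
        EqOn w (MEMS.vStar N p σ m) (Ico 0 r₀)) ∧
      ∃ v : ℝ → ℝ → ℝ,
        -- `v a` is the unique radial solution with value `a` at the origin
        (∀ a ∈ Ioo (0 : ℝ) 1,
          MEMS.IsRadialSolution N p σ m r₀ a (v a) ∧
          MEMS.Solves p σ m (Metric.ball 0 r₀) (MEMS.radial N (v a)) ∧
          ContDiffOn ℝ 2 (v a) (Ioo 0 r₀) ∧
          ∀ w : ℝ → ℝ, MEMS.IsRadialSolution N p σ m r₀ a w → EqOn w (v a) (Ico 0 r₀)) ∧
        (∀ᶠ a in 𝓝[<] (1 : ℝ), ∀ r ∈ Ico 0 r₀, 0 < v a r ∧ v a r < 1) ∧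
        -- convergence
        MEMS.ConvergesLoc r₀ (𝓝[<] (1 : ℝ)) v (MEMS.vStar N p σ m) ∧
        -- intersection number
        (MEMS.qcDenom N p σ ≤ 0 ∨ m / (m - p + 1) < MEMS.qc N p σ →
          ∀ ρ ∈ Ioo 0 r₀,
            Tendsto (fun a => MEMS.zeroNumber (Ioo 0 ρ) (fun r => v a r - MEMS.vStar N p σ m r))
              (𝓝[<] (1 : ℝ)) (𝓝 ⊤)) := by
  have h : MEMS.Admissible N p m σ := ⟨hp, hN, hm, hσ⟩
  have hp1 : 1 < p := by linarith
  have hN0 : 0 < N := by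
    have : (0:ℝ) < N := by linarith
    exact_mod_cast this
  have hθ := h.theta_pos
  obtain ⟨u, W, hs, huc, hu0, hW0⟩ := MEMS.exists_entire_profile h one_pos
  have hvS := MEMS.vStar_eq h
  set θ := MEMS.theta p m σ with hθdef
  set A := MEMS.amplitude N p m σ with hAdef
  have hA : 0 < A := MEMS.amplitude_pos
  -- `v*(r₀) = 1 / 2`
  set r₀ : ℝ := (1 / (2 * A)) ^ (1 / θ) with hr₀
  have hr₀0 : 0 < r₀ := by positivity
  have hAr₀ : A * r₀ ^ θ = 1 / 2 := by
    rw [hr₀, ← Real.rpow_mul (by positivity), one_div_mul_cancel hθ.ne', Real.rpow_one]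
    field_simp
  -- the scale `μ` of the solution with value `a` at the origin: `μ ^ θ = 1 - a`
  set μ : ℝ → ℝ := fun a => (1 - a) ^ (1 / θ) with hμ
  have hμ0 : ∀ a < 1, 0 < μ a := fun a ha => Real.rpow_pos_of_pos (by linarith) _
  have hμθ : ∀ a < 1, μ a ^ θ = 1 - a := fun a ha => by
    rw [hμ, ← Real.rpow_mul (by linarith), one_div_mul_cancel hθ.ne', Real.rpow_one]
  have hμlim : Tendsto μ (𝓝[<] 1) (𝓝[>] 0) := by
    refine tendsto_nhdsWithin_iff.2 ⟨?_, ?_⟩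
    · have h1 : Tendsto (fun a : ℝ => 1 - a) (𝓝[<] 1) (𝓝 (1 - 1)) :=
        (tendsto_id.const_sub 1).mono_left nhdsWithin_le_nhds
      have hθ' : 0 < 1 / θ := by positivity
      have h2 := h1.rpow_const (p := 1 / θ) (Or.inr hθ'.le)
      rwa [sub_self, Real.zero_rpow hθ'.ne'] at h2
    · filter_upwards [self_mem_nhdsWithin] with a ha using hμ0 a ha
  have hscale : ∀ a < 1, MEMS.ProfileSolution N p m σ (Ioi 0) (fun r => μ a ^ θ * u (r / μ a))
      (fun r => μ a ^ MEMS.zeta N p m σ * W (r / μ a)) := fun a ha => hs.scale h (hμ0 a ha)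
  have hcont : ∀ a < 1, ContinuousOn (fun r => μ a ^ θ * u (r / μ a)) (Ici 0) := fun a ha =>
    continuousOn_const.mul (huc.comp (continuousOn_id.div_const _)
      fun r hr => div_nonneg hr (hμ0 a ha).le)
  have hzero : ∀ a < 1, μ a ^ θ * u (0 / μ a) = 1 - a := fun a ha => by
    rw [zero_div, hu0, mul_one, hμθ a ha]
  have hrad : ∀ a < 1, MEMS.IsRadialSolution N p σ m r₀ a
      fun r => 1 - μ a ^ θ * u (r / μ a) := fun a ha =>
    ((hscale a ha).mono Ioo_subset_Ioi_self).isRadialSolution hp1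
      ((hcont a ha).mono Ico_subset_Ici_self) (hzero a ha)
  have hunif := MEMS.tendstoUniformlyOn_scale_Icc hθ (hs.tendsto_div_rpow h) huc r₀
  refine ⟨r₀, hr₀0, MEMS.isRadialSolution_vStar h, fun w hw => hw.eqOn_vStar h,
    fun a r => 1 - μ a ^ θ * u (r / μ a), ?_, ?_, ?_, ?_⟩
  · intro a ha
    refine ⟨hrad a ha.2, ?_, ?_, fun w hw => hw.eqOn_of_lt_one h ha.2 (hrad a ha.2)⟩
    · refine ((hscale a ha.2).mono Ioo_subset_Ioi_self).solves_ball hp hσ hN0 hr₀0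
        (α := 1 - a) (by linarith [ha.2]) (hzero a ha.2) ?_ ?_
      · have h1 : Tendsto (fun r => μ a ^ θ * u (r / μ a)) (𝓝[≥] 0)
            (𝓝 (μ a ^ θ * u (0 / μ a))) := hcont a ha.2 0 (mem_Ici.2 le_rfl)
        rw [hzero a ha.2] at h1
        exact h1.mono_left (nhdsWithin_mono 0 Ioi_subset_Ici_self)
      · have h1 : Tendsto (fun r => r / μ a) (𝓝[>] 0) (𝓝[>] 0) := by
          refine tendsto_nhdsWithin_iff.2 ⟨?_, ?_⟩
          · have := (tendsto_id (α := ℝ) (x := 𝓝 0)).div_const (μ a)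
            rw [zero_div] at this
            exact this.mono_left nhdsWithin_le_nhds
          · filter_upwards [self_mem_nhdsWithin] with r hr using div_pos hr (hμ0 a ha.2)
        simpa using (hW0.comp h1).const_mul (μ a ^ MEMS.zeta N p m σ)
    · exact contDiffOn_const.sub (((hscale a ha.2).contDiffOn hp1 isOpen_Ioi).mono
        Ioo_subset_Ioi_self)
  · have h1 := hμlim.eventually (Metric.tendstoUniformlyOn_iff.1 hunif (1 / 2) (by norm_num))
    filter_upwards [h1, self_mem_nhdsWithin] with a ha ha1 r hr
    have ha1' : a < 1 := ha1
    have h2 := ha r ⟨hr.1, hr.2.le⟩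
    rw [Real.dist_eq, abs_lt] at h2
    have h3 : A * r ^ θ ≤ A * r₀ ^ θ :=
      mul_le_mul_of_nonneg_left (Real.rpow_le_rpow hr.1 hr.2.le hθ.le) hA.le
    have h4 : 0 < μ a ^ θ * u (r / μ a) := by
      rcases hr.1.eq_or_lt with h0 | h0
      · rw [← h0, hzero a ha1']
        linarith
      · exact (hscale a ha1').u_pos r h0
    constructor <;> linarith [h2.1]
  · have hev : ∀ᶠ a in 𝓝[<] (1:ℝ), 0 < μ a := by
      filter_upwards [self_mem_nhdsWithin] with a ha using hμ0 a ha
    have hdu : ∀ b : ℝ, 0 < b → ∀ r : ℝ, 0 < r → HasDerivAt (fun r => 1 - b ^ θ * u (r / b))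
        (-(b ^ (θ - 1) * deriv u (r / b))) r := by
      intro b hb r hr
      have h1 := (hs.u_deriv (r / b) (div_pos hr hb)).differentiableAt.hasDerivAt
      refine (((h1.comp r ((hasDerivAt_id' r).div_const b)).const_mul (b ^ θ)).const_sub
        1).congr_deriv ?_
      rw [Real.rpow_sub_one hb.ne']
      ring
    have hddu : ∀ b : ℝ, 0 < b → ∀ r : ℝ, 0 < r →
        deriv (deriv fun r => 1 - b ^ θ * u (r / b)) r =
          -(b ^ (θ - 1 - 1) * deriv (deriv u) (r / b)) := by
      intro b hb r hr
      have h0 : deriv (fun r => 1 - b ^ θ * u (r / b)) =ᶠ[𝓝 r]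
          fun r => -(b ^ (θ - 1) * deriv u (r / b)) := by
        filter_upwards [lt_mem_nhds hr] with q hq using (hdu b hb q hq).deriv
      rw [h0.deriv_eq]
      have h1 := (hs.hasDerivAt_deriv hp1 isOpen_Ioi
        (div_pos hr hb : r / b ∈ Ioi 0)).differentiableAt.hasDerivAt
      refine ((((h1.comp r ((hasDerivAt_id' r).div_const b)).const_mul
        (b ^ (θ - 1))).neg).congr_deriv ?_).deriv
      rw [Real.rpow_sub_one hb.ne' (θ - 1)]
      ring
    have hdS : ∀ r : ℝ, 0 < r → deriv (fun r => 1 - A * r ^ θ) r = -(A * θ * r ^ (θ - 1)) := by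
      intro r hr
      refine ((((Real.hasDerivAt_rpow_const (p := θ) (Or.inl hr.ne')).const_mul A).const_sub
        1).congr_deriv ?_).deriv
      ring
    have hddS : ∀ r : ℝ, 0 < r → deriv (deriv fun r => 1 - A * r ^ θ) r =
        -(A * θ * (θ - 1) * r ^ (θ - 1 - 1)) := by
      intro r hr
      have h0 : deriv (fun r => 1 - A * r ^ θ) =ᶠ[𝓝 r] fun r => -(A * θ * r ^ (θ - 1)) := by
        filter_upwards [lt_mem_nhds hr] with q hq using hdS q hq
      rw [h0.deriv_eq]
      refine ((((Real.hasDerivAt_rpow_const (p := θ - 1) (Or.inl hr.ne')).const_mul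
        (A * θ)).neg).congr_deriv ?_).deriv
      ring
    rw [hvS]
    refine ⟨fun K hK hKc => ?_, fun K hK hKc => ?_, fun K hK hKc => ?_⟩
    · rw [Metric.tendstoUniformlyOn_iff] at hunif ⊢
      intro ε hε
      filter_upwards [hμlim.eventually (hunif ε hε)] with a ha r hr
      rw [dist_sub_left]
      exact ha r ⟨(hK hr).1, (hK hr).2.le⟩
    · have h1 := MEMS.tendstoUniformlyOn_scale (hs.tendsto_deriv_div_rpow h) hKc
        fun r hr => (hK hr).1
      rw [Metric.tendstoUniformlyOn_iff] at h1 ⊢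
      intro ε hε
      filter_upwards [hμlim.eventually (h1 ε hε), hev] with a ha ha0 r hr
      rw [hdS r (hK hr).1, (hdu (μ a) ha0 r (hK hr).1).deriv, dist_neg_neg]
      exact ha r hr
    · have h1 := MEMS.tendstoUniformlyOn_scale (hs.tendsto_deriv_deriv_div_rpow h) hKc
        fun r hr => (hK hr).1
      rw [Metric.tendstoUniformlyOn_iff] at h1 ⊢
      intro ε hε
      filter_upwards [hμlim.eventually (h1 ε hε), hev] with a ha ha0 r hr
      rw [hddS r (hK hr).1, hddu (μ a) ha0 r (hK hr).1, dist_neg_neg]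
      exact ha r hr
  · intro hqc ρ hρ
    have hosc := MEMS.oscillation_condition h hqc
    have h1 := (MEMS.tendsto_encard_dilate (Z := {s | 0 < s ∧ u s = A * s ^ θ})
      (fun s hs => hs.1) (fun S => by
        obtain ⟨s, hS, hs0, hsu⟩ := hs.exists_eq_amplitude_mul_rpow h hosc S
        exact ⟨s, ⟨hs0, hsu⟩, hS⟩) hρ.1).comp hμlim
    refine h1.congr' ?_
    filter_upwards [self_mem_nhdsWithin] with a ha
    have ha0 := hμ0 a ha
    rw [hvS]
    simp only [MEMS.zeroNumber, Function.comp]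
    congr 1
    ext r
    refine and_congr_right fun hr => ?_
    have hpow : μ a ^ θ * (A * (r / μ a) ^ θ) = A * r ^ θ := by
      rw [Real.div_rpow hr.1.le ha0.le]
      have := (Real.rpow_pos_of_pos ha0 θ).ne'
      field_simp
    have hμpos := (Real.rpow_pos_of_pos ha0 θ).ne'
    constructor
    · rintro ⟨-, h2⟩
      rw [h2, hpow]
      ring
    · intro h2
      refine ⟨div_pos hr.1 ha0, mul_left_cancel₀ hμpos ?_⟩
      rw [hpow]
      linarith
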